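/- Let $X$ be a finite set and let $(X,\{R_0,R_1,R_2,R_3\})$ be a symmetric association scheme of class $3$: $R_0,\dots,R_3$ are nonempty symmetric relations that partition $X\times X$, $R_0$ is the identity relation, and for all $i,j,h$ the number of $z$ with $(x,z)\in R_i$, $(z,y)\in R_j$ is the same for all $(x,y)\in R_h$. Let $A_0,\dots,A_3$ be the adjacency matrices, let $E_0=\frac1{|X|}J,E_1,E_2,E_3$ be an ordering of the primitive idempotents of the algebra $\mathrm{span}(A_0,\dots,A_3)$, and define the Krein parameters $q_{i,j}^h$ by $E_i\circ E_j=\frac1{|X|}\sum_h q_{i,j}^hE_h$, where $\circ$ is the entrywise product. Assume that the scheme is $Q$-polynomial with respect to this ordering, i.e. $q_{i,j}^h=0$ (resp. $q_{i,j}^h\neq0$) whenever one of $h,i,j$ is greater than (resp. equal to) the sum of the other two. Put $a_i^*=q_{1,i}^i$ and $b_1^*=q_{1,2}^1$, and let the dual eigenvalues $\theta_h^*$ be defined by $E_1=\frac1{|X|}\sum_h\theta_h^*A_h$, where $R_1,R_2,R_3$ are labelled so that $m=\theta_0^*>\theta_1^*>\theta_2^*>\theta_3^*$. The scheme is called $Q$-bipartite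 if $a_i^*=0$ for all $i$, and dual-tight if it is not $Q$-bipartite and $$\Big(\theta_1^*+\frac{m}{a_1^*+1}\Big)\Big(\theta_3^*+\frac{m}{a_1^*+1}\Big)=-\frac{m\,a_1^*\,b_1^*}{(a_1^*+1)^2}.$$ Then the scheme is dual-tight if and only if for some $i\neq0$ the graph $(X,R_i)$ is (isomorphic to) the incidence graph of a nontrivial symmetric design, that is, of an incidence structure with $v$ points and $v$ blocks such that every block has exactly $k$ points, where $1<k<v-1$, and any two distinct points lie on exactly $\lambda$ common blocks, for some integers $v,k,\lambda$. -/

import Mathlib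

universe u

open scoped Matrix

/-- A (symmetric) association scheme of class `d` on a finite set `X`.  The partition
`R_0, …, R_d` of `X × X` into nonempty relations is encoded by the function `rel` sending
`(x, y)` to the index `i` with `(x, y) ∈ R_i`. -/
structure AssociationScheme (X : Type u) [Fintype X] (d : ℕ) where
  rel : X → X → Fin (d + 1)
  rel_nonempty : ∀ i, ∃ x y, rel x y = i
  rel_eq_zero_iff : ∀ x y, rel x y = 0 ↔ x = y
  rel_symm : ∀ x y, rel x y = rel y x
  /-- The intersection numbers `p_{i,j}^h` are well defined. -/
  regular : ∀ i j h : Fin (d + 1), ∃ p : ℕ, ∀ x y, rel x y = h →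
    (Finset.univ.filter fun z => rel x z = i ∧ rel z y = j).card = p

namespace AssociationScheme

variable {X : Type u} [Fintype X] {d : ℕ}

/-- The adjacency matrix `A_i` of the relation `R_i`. -/
def adj (S : AssociationScheme X d) (i : Fin (d + 1)) : Matrix X X ℝ :=
  Matrix.of fun x y => if S.rel x y = i then 1 else 0

/-- The graph `(X, R_i)`, for `i ≠ 0`. -/
def graph (S : AssociationScheme X d) (i : Fin (d + 1)) (hi : i ≠ 0) : SimpleGraph X where
  Adj x y := S.rel x y = i
  symm := ⟨fun x y h => (S.rel_symm y x).trans h⟩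
  loopless := ⟨fun x h => hi (h.symm.trans ((S.rel_eq_zero_iff x x).2 rfl))⟩

end AssociationScheme

/-- An ordering `E_0 = J/|X|, E_1, …, E_d` of the primitive idempotents of the Bose–Mesner algebra
`span (A_0, …, A_d)`, together with the dual eigenvalues `Q h j`, that is, the coefficients in
`E_j = |X|⁻¹ ∑_h Q h j A_h` (they are determined by the `E_j`).  As the algebra has dimension
`d + 1`, the primitive idempotents are precisely `d + 1` nonzero, mutually orthogonal idempotents
of it. -/
structure PrimitiveIdempotents {X : Type u} [Fintype X] [DecidableEq X] {d : ℕ}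
    (S : AssociationScheme X d) where
  E : Fin (d + 1) → Matrix X X ℝ
  Q : Fin (d + 1) → Fin (d + 1) → ℝ
  E_eq : ∀ j, E j = (Fintype.card X : ℝ)⁻¹ • ∑ h, Q h j • S.adj h
  E_zero : E 0 = (Fintype.card X : ℝ)⁻¹ • Matrix.of fun _ _ => (1 : ℝ)
  E_ne_zero : ∀ j, E j ≠ 0
  E_idem : ∀ j, E j * E j = E j
  E_orth : ∀ i j, i ≠ j → E i * E j = 0
  E_sum : ∑ j, E j = 1

namespace PrimitiveIdempotents

variable {X : Type u} [Fintype X] [DecidableEq X] {d : ℕ} {S : AssociationScheme X d}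

/-- The Krein parameter `q_{i,j}^h`, that is, the coefficient in
`E_i ∘ E_j = |X|⁻¹ ∑_h q_{i,j}^h E_h` (see `hadamard_eq`), extracted by means of the trace. -/
noncomputable def krein (P : PrimitiveIdempotents S) (i j h : Fin (d + 1)) : ℝ :=
  (Fintype.card X : ℝ) * ((P.E i ⊙ P.E j) * P.E h).trace / (P.E h).trace

theorem trace_ne_zero (P : PrimitiveIdempotents S) (h : Fin (d + 1)) : (P.E h).trace ≠ 0 := by
  have hs : (P.E h)ᵀ = P.E h := by
    rw [P.E_eq]
    ext x y
    simp [Matrix.sum_apply, AssociationScheme.adj, S.rel_symm y x]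
  intro h0
  apply P.E_ne_zero h
  rw [← Matrix.trace_conjTranspose_mul_self_eq_zero_iff (A := P.E h),
    Matrix.conjTranspose_eq_transpose_of_trivial, hs, P.E_idem, h0]

theorem mem_span (P : PrimitiveIdempotents S) {M : Matrix X X ℝ}
    (hM : M ∈ Submodule.span ℝ (Set.range S.adj)) : M ∈ Submodule.span ℝ (Set.range P.E) := by
  have hli : LinearIndependent ℝ P.E := by
    rw [Fintype.linearIndependent_iff]
    intro g hg i
    have h1 : (∑ j, g j • P.E j) * P.E i = g i • P.E i := by
      rw [Finset.sum_mul, Finset.sum_eq_single i]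
      · rw [smul_mul_assoc, P.E_idem]
      · intro j _ hj
        rw [smul_mul_assoc, P.E_orth j i hj, smul_zero]
      · simp
    rw [hg, zero_mul] at h1
    exact (smul_eq_zero.1 h1.symm).resolve_right (P.E_ne_zero i)
  have hle : Submodule.span ℝ (Set.range P.E) ≤ Submodule.span ℝ (Set.range S.adj) := by
    rw [Submodule.span_le]
    rintro _ ⟨j, rfl⟩
    rw [P.E_eq]
    exact Submodule.smul_mem _ _ (Submodule.sum_mem _ fun h _ =>
      Submodule.smul_mem _ _ (Submodule.subset_span ⟨h, rfl⟩))
  have hfin : Module.finrank ℝ (Submodule.span ℝ (Set.range S.adj)) ≤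
      Module.finrank ℝ (Submodule.span ℝ (Set.range P.E)) := by
    rw [finrank_span_eq_card hli]
    exact finrank_range_le_card S.adj
  rw [Submodule.eq_of_le_of_finrank_le hle hfin]
  exact hM

theorem hadamard_eq (P : PrimitiveIdempotents S) (i j : Fin (d + 1)) :
    P.E i ⊙ P.E j = (Fintype.card X : ℝ)⁻¹ • ∑ h, P.krein i j h • P.E h := by
  have hcard : (Fintype.card X : ℝ) ≠ 0 := by
    obtain ⟨x, -⟩ := S.rel_nonempty 0
    have : Nonempty X := ⟨x⟩
    exact Nat.cast_ne_zero.2 Fintype.card_ne_zero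
  have hmem : P.E i ⊙ P.E j ∈ Submodule.span ℝ (Set.range S.adj) := by
    have : P.E i ⊙ P.E j = ∑ h, (((Fintype.card X : ℝ)⁻¹ * P.Q h i) *
        ((Fintype.card X : ℝ)⁻¹ * P.Q h j)) • S.adj h := by
      ext x y
      rw [Matrix.hadamard_apply, P.E_eq, P.E_eq]
      simp [Matrix.sum_apply, AssociationScheme.adj]
    rw [this]
    exact Submodule.sum_mem _ fun h _ =>
      Submodule.smul_mem _ _ (Submodule.subset_span ⟨h, rfl⟩)
  obtain ⟨c, hc⟩ := (Submodule.mem_span_range_iff_exists_fun ℝ).1 (P.mem_span hmem)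
  have hq : ∀ h, P.krein i j h = (Fintype.card X : ℝ) * c h := by
    intro h
    have h1 : (P.E i ⊙ P.E j) * P.E h = c h • P.E h := by
      rw [← hc, Finset.sum_mul, Finset.sum_eq_single h]
      · rw [smul_mul_assoc, P.E_idem]
      · intro l _ hl
        rw [smul_mul_assoc, P.E_orth l h hl, smul_zero]
      · simp
    rw [krein, h1, Matrix.trace_smul, smul_eq_mul]
    field_simp [P.trace_ne_zero h]
  rw [← hc, Finset.smul_sum]
  refine Finset.sum_congr rfl fun h _ => ?_
  rw [hq, smul_smul, inv_mul_cancel_left₀ hcard]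

/-- The scheme is `Q`-polynomial with respect to the ordering `E_0, …, E_d`: `q_{i,j}^h` vanishes
if one of `h, i, j` is greater than the sum of the other two, and does not vanish if one of them
equals the sum of the other two. -/
def IsQPolynomial (P : PrimitiveIdempotents S) : Prop :=
  ∀ i j h : Fin (d + 1),
    (((h : ℕ) > i + j ∨ (i : ℕ) > h + j ∨ (j : ℕ) > h + i) → P.krein i j h = 0) ∧
    (((h : ℕ) = i + j ∨ (i : ℕ) = h + j ∨ (j : ℕ) = h + i) → P.krein i j h ≠ 0)

end PrimitiveIdempotents

/-- A `Q`-polynomial structure on an association scheme: an ordering of the primitive idempotents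
with respect to which the scheme is `Q`-polynomial. -/
structure QPolynomialStructure {X : Type u} [Fintype X] [DecidableEq X] {d : ℕ}
    (S : AssociationScheme X d) extends PrimitiveIdempotents S where
  isQPolynomial : toPrimitiveIdempotents.IsQPolynomial

namespace QPolynomialStructure

variable {X : Type u} [Fintype X] [DecidableEq X] {d : ℕ} {S : AssociationScheme X d}

/-- The dual eigenvalue `θ_h^*` attached to the relation `R_h`:
`E_1 = |X|⁻¹ ∑_h θ_h^* A_h`. -/
def dualEigenvalue (P : QPolynomialStructure S) (h : Fin (d + 1)) : ℝ := P.Q h 1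

/-- `m = θ_0^*`, the rank of `E_1`. -/
def m (P : QPolynomialStructure S) : ℝ := P.dualEigenvalue 0

/-- The second largest dual eigenvalue.  The relations are labelled arbitrarily except for `R_0`,
and `θ_0^* = m` is the largest dual eigenvalue. -/
noncomputable def thetaSecond (P : QPolynomialStructure S) : ℝ :=
  ⨆ h : {h : Fin (d + 1) // h ≠ 0}, P.dualEigenvalue h

/-- The smallest dual eigenvalue. -/
noncomputable def thetaLast (P : QPolynomialStructure S) : ℝ :=
  ⨅ h : Fin (d + 1), P.dualEigenvalue h

/-- `a_i^* = q_{1,i}^i`. -/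
noncomputable def aStar (P : QPolynomialStructure S) (i : Fin (d + 1)) : ℝ := P.krein 1 i i

/-- `b_i^* = q_{1,i+1}^i` (for `i < d`). -/
noncomputable def bStar (P : QPolynomialStructure S) (i : Fin d) : ℝ :=
  P.krein 1 i.succ i.castSucc

/-- `Q`-bipartite: all `a_i^*` vanish. -/
def IsQBipartite (P : QPolynomialStructure S) : Prop := ∀ i, P.aStar i = 0

end QPolynomialStructure

/-- Dual-tight: not `Q`-bipartite, with equality in the dual fundamental bound.  The class is
`d + 2 ≥ 2`, so that `b_1^*` makes sense. -/
def QPolynomialStructure.IsDualTight {X : Type u} [Fintype X] [DecidableEq X] {d : ℕ}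
    {S : AssociationScheme X (d + 2)} (P : QPolynomialStructure S) : Prop :=
  ¬ P.IsQBipartite ∧
    (P.thetaSecond + P.m / (P.aStar 1 + 1)) * (P.thetaLast + P.m / (P.aStar 1 + 1)) =
      -(P.m * P.aStar 1 * P.bStar 1 / (P.aStar 1 + 1) ^ 2)

/-- A (nontrivial) symmetric `2-(v, k, l)` design with points `P` and blocks `B`: `v` points,
`v` blocks, `k` points on every block with `1 < k < v - 1`, and `l` blocks through any two distinct
points. -/
structure SymmetricDesign (P B : Type u) [Fintype P] [Fintype B] where
  inc : P → B → Prop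
  v : ℕ
  k : ℕ
  l : ℕ
  card_points : Fintype.card P = v
  card_blocks : Fintype.card B = v
  block_size : ∀ b, {p | inc p b}.ncard = k
  balanced : ∀ p q, p ≠ q → {b | inc p b ∧ inc q b}.ncard = l
  one_lt_k : 1 < k
  k_lt : k + 1 < v

/-- The incidence graph: the bipartite graph on points and blocks, a point being adjacent to the
blocks it is incident with. -/
def SymmetricDesign.incidenceGraph {P B : Type u} [Fintype P] [Fintype B]
    (D : SymmetricDesign P B) : SimpleGraph (P ⊕ B) where
  Adj
    | .inl p, .inr b => D.inc p b
    | .inr b, .inl p => D.inc p b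
    | _, _ => False
  symm := ⟨by rintro (p | b) (q | c) h <;> exact h⟩
  loopless := ⟨by rintro (p | b) h <;> exact h⟩

/-- A graph is (isomorphic to) the incidence graph of a symmetric design. -/
def IsSymmetricDesignIncidenceGraph {X : Type u} (G : SimpleGraph X) : Prop :=
  ∃ (P B : Type u) (_ : Fintype P) (_ : Fintype B) (D : SymmetricDesign P B),
    Nonempty (G ≃g D.incidenceGraph)

/-!
Up to a positive factor, the slack in the dual fundamental bound is the variance of `θ_{yz}` over
`y ∈ R_1(x)`, `z ∈ R_3(x)`. If the scheme is dual-tight, then all these pairs `(y, z)` lie in one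
relation, which must be `R_2`, so that `m θ_2 = θ_1 θ_3`. Nonnegativity of the multiplicities and
Krein parameters then squeezes `θ_2` to `-1`, and `E_3` has rank one. A rank-one `E_3` is the
signature of a bipartition with `R_1` and `R_3` across and `R_0` and `R_2` within the parts: the
graph of `R_1` is the incidence graph of a symmetric design.

Conversely, the incidence graph of a symmetric design spans a bipartition whose signature is a
rank-one idempotent of the Bose–Mesner algebra, and `E_3` is the only candidate. Then `θ_1` and
`θ_3` are the roots of `t ^ 2 - (a₁ - b₁) t - m`, which makes the slack vanish; and as
`(k₁ - 1) (k₃ - 1)` is a positive multiple of `a₁`, nontriviality of the design rules out the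
`Q`-bipartite case.
-/

theorem cubic_vieta {K : Type*} [CommRing K] [IsDomain K] {x y z p q r : K} (hxy : x ≠ y)
    (hxz : x ≠ z) (hyz : y ≠ z) (hx : x ^ 3 + p * x ^ 2 + q * x + r = 0)
    (hy : y ^ 3 + p * y ^ 2 + q * y + r = 0) (hz : z ^ 3 + p * z ^ 2 + q * z + r = 0) :
    p = -(x + y + z) ∧ q = x * y + x * z + y * z ∧ r = -(x * y * z) := by
  have hxy' : x ^ 2 + x * y + y ^ 2 + p * (x + y) + q = 0 :=
    mul_left_cancel₀ (sub_ne_zero.2 hxy) (by linear_combination hx - hy)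
  have hxz' : x ^ 2 + x * z + z ^ 2 + p * (x + z) + q = 0 :=
    mul_left_cancel₀ (sub_ne_zero.2 hxz) (by linear_combination hx - hz)
  have hp : p = -(x + y + z) :=
    mul_left_cancel₀ (sub_ne_zero.2 hyz) (by linear_combination hxy' - hxz')
  have hq : q = x * y + x * z + y * z := by linear_combination hxy' - (x + y) * hp
  exact ⟨hp, hq, by linear_combination hx - x ^ 2 * hp - x * hq⟩

theorem ncard_subtype_of_imp {α : Type*} [Fintype α] {p r : α → Prop} [DecidablePred r]
    (h : ∀ x, r x → p x) : {x : Subtype p | r x}.ncard = (Finset.univ.filter r).card := by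
  rw [← Set.ncard_coe_finset, Finset.coe_filter_univ]
  exact (Set.ncard_subtype p {x | r x}).trans
    (congrArg Set.ncard (Set.inter_eq_left.2 fun x hx => h x hx))

namespace AssociationScheme

variable {X : Type u} [Fintype X] {d : ℕ} (S : AssociationScheme X d)

open Finset

theorem rel_self (x : X) : S.rel x x = 0 := (S.rel_eq_zero_iff x x).2 rfl

theorem card_pos (S : AssociationScheme X d) : (0 : ℝ) < Fintype.card X := by
  obtain ⟨x, -⟩ := S.rel_nonempty 0
  have : Nonempty X := ⟨x⟩
  exact Nat.cast_pos.2 Fintype.card_pos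

/-- The valency `k_h` of the relation `R_h`, i.e. the intersection number `p_{h,h}^0`. -/
noncomputable def valency (h : Fin (d + 1)) : ℕ := (S.regular h h 0).choose

theorem card_rel (h : Fin (d + 1)) (x : X) : #{z | S.rel x z = h} = S.valency h := by
  rw [valency, ← (S.regular h h 0).choose_spec x x (S.rel_self x)]
  simp only [S.rel_symm _ x, and_self]

theorem valency_pos (h : Fin (d + 1)) : 0 < S.valency h := by
  obtain ⟨x, y, hxy⟩ := S.rel_nonempty h
  rw [← S.card_rel h x]
  exact Finset.card_pos.2 ⟨y, by simp [hxy]⟩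

theorem exists_rel (h : Fin (d + 1)) (x : X) : ∃ y, S.rel x y = h := by
  have hpos := S.valency_pos h
  rw [← S.card_rel h x, Finset.card_pos] at hpos
  simpa [Finset.Nonempty] using hpos

theorem valency_zero : S.valency 0 = 1 := by
  obtain ⟨x, -⟩ := S.rel_nonempty 0
  rw [← S.card_rel 0 x, Finset.card_eq_one]
  exact ⟨x, by ext z; simp [S.rel_eq_zero_iff, eq_comm]⟩

theorem sum_rel {M : Type*} [NonAssocSemiring M] (f : Fin (d + 1) → M) (x : X) :
    ∑ z, f (S.rel x z) = ∑ h, S.valency h * f h := by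
  rw [← Finset.sum_fiberwise univ (S.rel x)]
  refine Finset.sum_congr rfl fun h _ => ?_
  rw [Finset.sum_congr rfl fun z hz => by rw [(Finset.mem_filter.1 hz).2], Finset.sum_const,
    S.card_rel, nsmul_eq_mul]

theorem sum_valency : ∑ h, S.valency h = Fintype.card X := by
  obtain ⟨x, -⟩ := S.rel_nonempty 0
  simpa using (S.sum_rel (fun _ => (1 : ℕ)) x).symm

end AssociationScheme

namespace PrimitiveIdempotents

variable {X : Type u} [Fintype X] [DecidableEq X] {d : ℕ} {S : AssociationScheme X d}
  (P : PrimitiveIdempotents S)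

open Finset

theorem E_apply (j : Fin (d + 1)) (x y : X) :
    P.E j x y = (Fintype.card X : ℝ)⁻¹ * P.Q (S.rel x y) j := by
  simp [P.E_eq, Matrix.sum_apply, AssociationScheme.adj]

theorem Q_rel (j : Fin (d + 1)) (x y : X) :
    P.Q (S.rel x y) j = Fintype.card X * P.E j x y := by
  rw [P.E_apply, mul_inv_cancel_left₀ S.card_pos.ne']

theorem E_isHermitian (j : Fin (d + 1)) : (P.E j).IsHermitian := by
  ext x y
  simp [P.E_apply, S.rel_symm y x]

theorem E_posSemidef (j : Fin (d + 1)) : (P.E j).PosSemidef := by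
  have hsq := Matrix.posSemidef_conjTranspose_mul_self (P.E j)
  rwa [(P.E_isHermitian j).eq, P.E_idem] at hsq

theorem trace_E (j : Fin (d + 1)) : (P.E j).trace = P.Q 0 j := by
  simp [Matrix.trace, P.E_apply, S.rel_self, S.card_pos.ne']

theorem Q_zero_pos (j : Fin (d + 1)) : 0 < P.Q 0 j := by
  rw [← P.trace_E]
  exact (P.E_posSemidef j).trace_nonneg.lt_of_ne (P.trace_ne_zero j).symm

theorem Q_zero_right (h : Fin (d + 1)) : P.Q h 0 = 1 := by
  obtain ⟨x, y, rfl⟩ := S.rel_nonempty h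
  simp [P.Q_rel, P.E_zero, S.card_pos.ne']

theorem sum_Q (h : Fin (d + 1)) : ∑ j, P.Q h j = if h = 0 then (Fintype.card X : ℝ) else 0 := by
  obtain ⟨x, y, rfl⟩ := S.rel_nonempty h
  simp only [P.Q_rel, ← Finset.mul_sum, ← Matrix.sum_apply, P.E_sum, Matrix.one_apply,
    S.rel_eq_zero_iff, mul_ite, mul_one, mul_zero]

theorem sum_Q_mul_Q (i j : Fin (d + 1)) (x y : X) :
    ∑ z, P.Q (S.rel x z) i * P.Q (S.rel y z) j =
      if i = j then Fintype.card X * P.Q (S.rel x y) i else 0 := by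
  have hprod : (P.E i * P.E j) x y = if i = j then P.E i x y else 0 := by
    split_ifs with hij
    · rw [← hij, P.E_idem]
    · rw [P.E_orth i j hij, Matrix.zero_apply]
  have hsum : ∑ z, P.Q (S.rel x z) i * P.Q (S.rel y z) j =
      (Fintype.card X : ℝ) ^ 2 * (P.E i * P.E j) x y := by
    rw [Matrix.mul_apply, Finset.mul_sum]
    refine Finset.sum_congr rfl fun z _ => ?_
    rw [P.Q_rel, S.rel_symm y z, P.Q_rel]
    ring
  rw [hsum, hprod, P.Q_rel]
  split_ifs <;> ring

theorem sum_valency_mul_Q_mul_Q (i j : Fin (d + 1)) :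
    ∑ g, S.valency g * (P.Q g i * P.Q g j) = if i = j then Fintype.card X * P.Q 0 i else 0 := by
  obtain ⟨x, -⟩ := S.rel_nonempty 0
  rw [← S.sum_rel (fun g => P.Q g i * P.Q g j) x, P.sum_Q_mul_Q, S.rel_self]

theorem sum_Q_add_sq (j : Fin (d + 1)) (x y : X) (c : ℝ) :
    ∑ z, (P.Q (S.rel x z) j + c * P.Q (S.rel y z) j) ^ 2 =
      Fintype.card X * ((1 + c ^ 2) * P.Q 0 j + 2 * c * P.Q (S.rel x y) j) := by
  have hxx := P.sum_Q_mul_Q j j x x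
  have hxy := P.sum_Q_mul_Q j j x y
  have hyy := P.sum_Q_mul_Q j j y y
  simp only [if_true, S.rel_self] at hxx hxy hyy
  calc _ = ∑ z, P.Q (S.rel x z) j * P.Q (S.rel x z) j +
        2 * c * ∑ z, P.Q (S.rel x z) j * P.Q (S.rel y z) j +
        c ^ 2 * ∑ z, P.Q (S.rel y z) j * P.Q (S.rel y z) j := by
        simp only [Finset.mul_sum, ← Finset.sum_add_distrib]
        exact Finset.sum_congr rfl fun z _ => by ring
    _ = _ := by rw [hxx, hxy, hyy]; ring

theorem Q_le_Q_zero (h j : Fin (d + 1)) : P.Q h j ≤ P.Q 0 j := by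
  obtain ⟨x, y, rfl⟩ := S.rel_nonempty h
  have hsq : 0 ≤ ∑ z, (P.Q (S.rel x z) j + (-1) * P.Q (S.rel y z) j) ^ 2 :=
    Finset.sum_nonneg fun z _ => sq_nonneg _
  rw [P.sum_Q_add_sq] at hsq
  linarith [nonneg_of_mul_nonneg_right hsq S.card_pos]

theorem neg_Q_zero_le_Q (h j : Fin (d + 1)) : -P.Q 0 j ≤ P.Q h j := by
  obtain ⟨x, y, rfl⟩ := S.rel_nonempty h
  have hsq : 0 ≤ ∑ z, (P.Q (S.rel x z) j + 1 * P.Q (S.rel y z) j) ^ 2 :=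
    Finset.sum_nonneg fun z _ => sq_nonneg _
  rw [P.sum_Q_add_sq] at hsq
  linarith [nonneg_of_mul_nonneg_right hsq S.card_pos]

theorem Q_mul_Q (h i j : Fin (d + 1)) :
    P.Q h i * P.Q h j = ∑ l, P.krein i j l * P.Q h l := by
  obtain ⟨x, y, rfl⟩ := S.rel_nonempty h
  have hxy : P.E i x y * P.E j x y =
      (Fintype.card X : ℝ)⁻¹ * ∑ l, P.krein i j l * P.E l x y := by
    simpa only [Matrix.hadamard_apply, Matrix.smul_apply, Matrix.sum_apply, smul_eq_mul] using
      congrFun (congrFun (P.hadamard_eq i j) x) y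
  have hn := S.card_pos.ne'
  simp only [P.E_apply, mul_left_comm (P.krein i j _), ← Finset.mul_sum] at hxy
  field_simp at hxy
  exact hxy

theorem krein_mul (i j h : Fin (d + 1)) :
    P.krein i j h * (Fintype.card X * P.Q 0 h) =
      ∑ g, S.valency g * (P.Q g i * P.Q g j * P.Q g h) := by
  simp only [P.Q_mul_Q _ i j, Finset.sum_mul, Finset.mul_sum]
  rw [Finset.sum_comm]
  simp only [mul_assoc, mul_left_comm _ (P.krein i j _), ← Finset.mul_sum,
    P.sum_valency_mul_Q_mul_Q]
  simp

theorem krein_nonneg (i j h : Fin (d + 1)) : 0 ≤ P.krein i j h := by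
  have hconj : ((P.E i ⊙ P.E j) * P.E h).trace =
      (P.E h * (P.E i ⊙ P.E j) * (P.E h)ᴴ).trace := by
    rw [(P.E_isHermitian h).eq, Matrix.trace_mul_comm (P.E h * _), ← Matrix.mul_assoc, P.E_idem,
      Matrix.trace_mul_comm]
  have hpos := (((P.E_posSemidef i).hadamard (P.E_posSemidef j)).mul_mul_conjTranspose_same
    (P.E h)).trace_nonneg
  rw [krein, P.trace_E, hconj]
  exact div_nonneg (mul_nonneg S.card_pos.le hpos) (P.Q_zero_pos h).le

theorem krein_comm (i j h : Fin (d + 1)) : P.krein i j h = P.krein j i h := by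
  rw [krein, krein, Matrix.hadamard_comm]

theorem krein_mul_rotate (i j h : Fin (d + 1)) :
    P.krein i j h * P.Q 0 h = P.krein h j i * P.Q 0 i := by
  apply mul_left_cancel₀ S.card_pos.ne'
  rw [mul_left_comm, P.krein_mul, mul_left_comm, P.krein_mul]
  exact Finset.sum_congr rfl fun g _ => by ring

theorem krein_zero_mid (i h : Fin (d + 1)) : P.krein i 0 h = if i = h then 1 else 0 := by
  have hQ := P.krein_mul i 0 h
  simp only [P.Q_zero_right, mul_one, P.sum_valency_mul_Q_mul_Q] at hQ
  apply mul_right_cancel₀ (mul_pos S.card_pos (P.Q_zero_pos h)).ne'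
  rw [hQ]
  split_ifs with hih
  · rw [hih, one_mul]
  · rw [zero_mul]

theorem krein_self_zero (i : Fin (d + 1)) : P.krein i i 0 = P.Q 0 i := by
  have hrot := P.krein_mul_rotate i i 0
  rwa [P.Q_zero_right, mul_one, P.krein_comm 0, P.krein_zero_mid, if_pos rfl, one_mul] at hrot

theorem sum_krein (i h : Fin (d + 1)) : ∑ j, P.krein i j h = P.Q 0 i := by
  have hsum (g : Fin (d + 1)) : ∑ j, (S.valency g : ℝ) * (P.Q g i * P.Q g j * P.Q g h) =
      if g = 0 then Fintype.card X * (P.Q 0 i * P.Q 0 h) else 0 := by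
    rw [← Finset.mul_sum, ← Finset.sum_mul, ← Finset.mul_sum, P.sum_Q]
    split_ifs with hg
    · rw [hg, S.valency_zero]
      ring
    · ring
  apply mul_right_cancel₀ (mul_pos S.card_pos (P.Q_zero_pos h)).ne'
  rw [Finset.sum_mul, Finset.sum_congr rfl fun j _ => P.krein_mul i j h, Finset.sum_comm,
    Finset.sum_congr rfl fun g _ => hsum g, Finset.sum_ite_eq' univ 0, if_pos (mem_univ _)]
  ring

theorem krein_le (i j h : Fin (d + 1)) : P.krein i j h ≤ P.Q 0 i :=
  P.sum_krein i h ▸ Finset.single_le_sum (fun l _ => P.krein_nonneg i l h) (mem_univ j)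

theorem one_le_Q_zero (i : Fin (d + 1)) : 1 ≤ P.Q 0 i := by
  simpa [P.krein_zero_mid] using P.krein_le i 0 i

theorem exists_adj_eq_sum (h : Fin (d + 1)) :
    ∃ c : Fin (d + 1) → ℝ, S.adj h = ∑ l, c l • P.E l := by
  obtain ⟨c, hc⟩ := (Submodule.mem_span_range_iff_exists_fun ℝ).1
    (P.mem_span (Submodule.subset_span ⟨h, rfl⟩))
  exact ⟨c, hc.symm⟩

theorem sum_smul_E_mul_E (c : Fin (d + 1) → ℝ) (j : Fin (d + 1)) :
    (∑ l, c l • P.E l) * P.E j = c j • P.E j := by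
  rw [Finset.sum_mul, Finset.sum_eq_single_of_mem j (mem_univ j), smul_mul_assoc, P.E_idem]
  intro l _ hl
  rw [smul_mul_assoc, P.E_orth l j hl, smul_zero]

theorem adj_mul_E (h j : Fin (d + 1)) :
    S.adj h * P.E j = (S.valency h * P.Q h j / P.Q 0 j) • P.E j := by
  obtain ⟨c, hc⟩ := P.exists_adj_eq_sum h
  have hmul : S.adj h * P.E j = c j • P.E j := by rw [hc, P.sum_smul_E_mul_E]
  obtain ⟨x, -⟩ := S.rel_nonempty 0
  have hdiag : (S.adj h * P.E j) x x = (Fintype.card X : ℝ)⁻¹ * (S.valency h * P.Q h j) := by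
    have hterm (z : X) : S.adj h x z * P.E j z x = (Fintype.card X : ℝ)⁻¹ *
        if S.rel x z = h then P.Q (S.rel x z) j else 0 := by
      simp [AssociationScheme.adj, P.E_apply, S.rel_symm z x]
    rw [Matrix.mul_apply, Finset.sum_congr rfl fun z _ => hterm z, ← Finset.mul_sum,
      S.sum_rel fun g => if g = h then P.Q g j else 0]
    simp
  rw [hmul, Matrix.smul_apply, P.E_apply, S.rel_self, smul_eq_mul, mul_left_comm] at hdiag
  rw [hmul, ← mul_left_cancel₀ (inv_ne_zero S.card_pos.ne') hdiag,
    mul_div_cancel_right₀ _ (P.Q_zero_pos j).ne']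

theorem sum_rel_Q (h j : Fin (d + 1)) (x z : X) :
    ∑ y with S.rel x y = h, P.Q (S.rel y z) j =
      S.valency h * P.Q h j / P.Q 0 j * P.Q (S.rel x z) j := by
  have hxz := congrFun (congrFun (P.adj_mul_E h j) x) z
  rw [Matrix.mul_apply, Matrix.smul_apply, smul_eq_mul] at hxz
  simp only [P.Q_rel, ← Finset.mul_sum, Finset.sum_filter]
  rw [mul_left_comm, ← hxz]
  simp [AssociationScheme.adj]

theorem sum_sum_rel_Q (h g j : Fin (d + 1)) (x : X) :
    ∑ y with S.rel x y = h, ∑ z with S.rel x z = g, P.Q (S.rel y z) j =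
      S.valency h * S.valency g * (P.Q h j * P.Q g j / P.Q 0 j) := by
  rw [Finset.sum_comm]
  calc _ = ∑ z with S.rel x z = g, S.valency h * P.Q h j / P.Q 0 j * P.Q g j :=
        Finset.sum_congr rfl fun z hz => by rw [P.sum_rel_Q, (Finset.mem_filter.1 hz).2]
    _ = _ := by
        rw [Finset.sum_const, S.card_rel, nsmul_eq_mul]
        ring

theorem Q_injective : Function.Injective P.Q := by
  intro h g hQ
  obtain ⟨c, hc⟩ := P.exists_adj_eq_sum h
  obtain ⟨x, y, hxy⟩ := S.rel_nonempty h
  obtain ⟨x', y', hxy'⟩ := S.rel_nonempty g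
  have hadj : S.adj h x y = S.adj h x' y' := by
    simp only [hc, Matrix.sum_apply, Matrix.smul_apply, P.E_apply, hxy, hxy', hQ]
  by_contra hne
  simp [AssociationScheme.adj, hxy, hxy', Ne.symm hne] at hadj

theorem Q_eq_of_krein_ne_zero {h i j l : Fin (d + 1)} {δ ε : ℝ} (hδ : δ ^ 2 = 1) (hε : ε ^ 2 = 1)
    (hi : P.Q h i = δ * P.Q 0 i) (hj : P.Q h j = ε * P.Q 0 j) (hl : P.krein i j l ≠ 0) :
    P.Q h l = δ * ε * P.Q 0 l := by
  have hδε : (δ * ε) ^ 2 = 1 := by rw [mul_pow, hδ, hε, one_mul]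
  have hnonneg (l : Fin (d + 1)) : 0 ≤ P.krein i j l * (P.Q 0 l - δ * ε * P.Q h l) := by
    refine mul_nonneg (P.krein_nonneg i j l) ?_
    rcases sq_eq_one_iff.1 hδε with hsign | hsign
    · rw [hsign]; linarith [P.Q_le_Q_zero h l]
    · rw [hsign]; linarith [P.neg_Q_zero_le_Q h l]
  have hsum : ∑ l, P.krein i j l * (P.Q 0 l - δ * ε * P.Q h l) = 0 := by
    have h0 := P.Q_mul_Q 0 i j
    have hh := P.Q_mul_Q h i j
    simp only [mul_sub, mul_left_comm _ (δ * ε), Finset.sum_sub_distrib, ← Finset.mul_sum,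
      ← h0, ← hh, hi, hj]
    linear_combination -P.Q 0 i * P.Q 0 j * hδε
  have hzero := (Finset.sum_eq_zero_iff_of_nonneg fun l _ => hnonneg l).1 hsum l (mem_univ l)
  linear_combination (-δ * ε) * (mul_eq_zero.1 hzero).resolve_left hl - P.Q h l * hδε

theorem Q_rel_eq_of_Q_rel_eq {j : Fin (d + 1)} {x y : X} {ε : ℝ} (hε : ε ^ 2 = 1)
    (hxy : P.Q (S.rel x y) j = ε * P.Q 0 j) (z : X) :
    P.Q (S.rel x z) j = ε * P.Q (S.rel y z) j := by
  have hsum := P.sum_Q_add_sq j x y (-ε)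
  rw [hxy, show (1 + (-ε) ^ 2) * P.Q 0 j + 2 * -ε * (ε * P.Q 0 j) = (1 - ε ^ 2) * P.Q 0 j by ring,
    hε, sub_self, zero_mul, mul_zero,
    Finset.sum_eq_zero_iff_of_nonneg fun z _ => sq_nonneg _] at hsum
  linear_combination sq_eq_zero_iff.1 (hsum z (mem_univ z))

theorem krein_self_of_Q_zero_eq_one {s j : Fin (d + 1)} (hs : P.Q 0 s = 1) (hj : j ≠ 0) :
    P.krein s s j = 0 := by
  have hsum : P.krein s 0 s + P.krein s j s ≤ P.Q 0 s :=
    (Finset.add_le_sum (fun l _ => P.krein_nonneg s l s) (mem_univ 0) (mem_univ j)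
      hj.symm).trans_eq (P.sum_krein s s)
  rw [P.krein_zero_mid, if_pos rfl, hs, P.krein_comm] at hsum
  have hrot := P.krein_mul_rotate s s j
  rw [le_antisymm (by linarith) (P.krein_nonneg j s s), zero_mul] at hrot
  exact (mul_eq_zero.1 hrot).resolve_right (P.Q_zero_pos j).ne'

theorem Q_sq_of_Q_zero_eq_one {s : Fin (d + 1)} (hs : P.Q 0 s = 1) (h : Fin (d + 1)) :
    P.Q h s ^ 2 = 1 := by
  rw [sq, P.Q_mul_Q, Finset.sum_eq_single_of_mem 0 (mem_univ 0) fun l _ hl => by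
    rw [P.krein_self_of_Q_zero_eq_one hs hl, zero_mul], P.krein_self_zero, hs, P.Q_zero_right,
    one_mul]

theorem Q_rel_mul_of_Q_zero_eq_one {s : Fin (d + 1)} (hs : P.Q 0 s = 1) (x y z : X) :
    P.Q (S.rel x z) s = P.Q (S.rel x y) s * P.Q (S.rel y z) s :=
  P.Q_rel_eq_of_Q_rel_eq (P.Q_sq_of_Q_zero_eq_one hs _) (by rw [hs, mul_one]) z

theorem krein_eq_one_of_Q_zero_eq_one {s i h : Fin (d + 1)} (hs : P.Q 0 s = 1)
    (hk : P.krein s i h ≠ 0) : P.krein s i h = 1 := by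
  have hsq : ∑ l, P.krein s i l ^ 2 * P.Q 0 l = P.Q 0 i := by
    apply mul_left_cancel₀ S.card_pos.ne'
    calc _ = ∑ l, P.krein s i l * ∑ g, S.valency g * (P.Q g s * P.Q g i * P.Q g l) := by
          rw [Finset.mul_sum]
          exact Finset.sum_congr rfl fun l _ => by rw [← P.krein_mul]; ring
      _ = ∑ g, S.valency g * (P.Q g s * P.Q g i) * ∑ l, P.krein s i l * P.Q g l := by
          simp only [Finset.mul_sum]
          rw [Finset.sum_comm]
          exact Finset.sum_congr rfl fun g _ => Finset.sum_congr rfl fun l _ => by ring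
      _ = ∑ g, S.valency g * (P.Q g i * P.Q g i) :=
          Finset.sum_congr rfl fun g _ => by
            rw [← P.Q_mul_Q]
            linear_combination S.valency g * P.Q g i ^ 2 * P.Q_sq_of_Q_zero_eq_one hs g
      _ = _ := by rw [P.sum_valency_mul_Q_mul_Q, if_pos rfl]
  have hnonneg (l : Fin (d + 1)) : 0 ≤ P.krein s i l * (1 - P.krein s i l) * P.Q 0 l :=
    mul_nonneg (mul_nonneg (P.krein_nonneg s i l) (by linarith [P.krein_le s i l]))
      (P.Q_zero_pos l).le
  have hsum : ∑ l, P.krein s i l * (1 - P.krein s i l) * P.Q 0 l = 0 := by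
    have hlin := P.Q_mul_Q 0 s i
    rw [hs, one_mul, ← hsq] at hlin
    rw [← sub_eq_zero.2 hlin.symm, ← Finset.sum_sub_distrib]
    exact Finset.sum_congr rfl fun l _ => by ring
  have hzero := (Finset.sum_eq_zero_iff_of_nonneg fun l _ => hnonneg l).1 hsum h (mem_univ h)
  linarith [(mul_eq_zero.1 ((mul_eq_zero.1 hzero).resolve_right (P.Q_zero_pos h).ne')).resolve_left
    hk]

end PrimitiveIdempotents

/-- The vertices satisfying `side` form one part of a bipartition of `X` such that the pairs with
ends in different parts are precisely those in `⋃_{h ∈ T} R_h`. -/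
def AssociationScheme.IsBipartition {X : Type u} [Fintype X] {d : ℕ} (S : AssociationScheme X d)
    (side : X → Prop) (T : Set (Fin (d + 1))) : Prop :=
  ∀ x y, S.rel x y ∈ T ↔ ¬(side x ↔ side y)

namespace PrimitiveIdempotents

variable {X : Type u} [Fintype X] [DecidableEq X] {d : ℕ} {S : AssociationScheme X d}
  (P : PrimitiveIdempotents S)

open Finset

theorem isBipartition_of_Q_zero_eq_one {s : Fin (d + 1)} (hs : P.Q 0 s = 1) (x₀ : X) :
    S.IsBipartition (fun y => P.Q (S.rel x₀ y) s = 1) {h | P.Q h s = -1} := by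
  intro x y
  have hmul := P.Q_rel_mul_of_Q_zero_eq_one hs x₀ x y
  rcases sq_eq_one_iff.1 (P.Q_sq_of_Q_zero_eq_one hs (S.rel x₀ x)) with hx | hx <;>
  rcases sq_eq_one_iff.1 (P.Q_sq_of_Q_zero_eq_one hs (S.rel x y)) with hy | hy <;>
  norm_num [hmul, hx, hy]

theorem eq_E_of_mul_self_of_trace_eq_one {c : Fin (d + 1) → ℝ}
    (hidem : (∑ l, c l • P.E l) * (∑ l, c l • P.E l) = ∑ l, c l • P.E l)
    (htrace : (∑ l, c l • P.E l).trace = 1) : ∃ s, P.Q 0 s = 1 ∧ ∑ l, c l • P.E l = P.E s := by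
  have hc (l : Fin (d + 1)) : c l = 0 ∨ c l = 1 := by
    have hl := congrArg (· * P.E l) hidem
    simp only [Matrix.mul_assoc, P.sum_smul_E_mul_E, mul_smul_comm, smul_smul] at hl
    have hcl := smul_left_injective ℝ (P.E_ne_zero l) hl
    have hcl0 : c l * (c l - 1) = 0 := by linear_combination hcl
    exact (mul_eq_zero.1 hcl0).imp_right sub_eq_zero.1
  simp only [Matrix.trace_sum, Matrix.trace_smul, P.trace_E, smul_eq_mul] at htrace
  obtain ⟨s, -, hs⟩ := Finset.exists_ne_zero_of_sum_ne_zero (htrace.trans_ne one_ne_zero)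
  have hcs : c s = 1 := (hc s).resolve_left fun h0 => hs (by rw [h0, zero_mul])
  have hnonneg (l : Fin (d + 1)) : 0 ≤ c l * P.Q 0 l := by
    rcases hc l with h0 | h1
    · rw [h0, zero_mul]
    · rw [h1, one_mul]; exact (P.Q_zero_pos l).le
  have hs_le : c s * P.Q 0 s ≤ 1 :=
    htrace ▸ Finset.single_le_sum (fun l _ => hnonneg l) (mem_univ s)
  rw [hcs, one_mul] at hs_le
  refine ⟨s, le_antisymm hs_le (P.one_le_Q_zero s), ?_⟩
  rw [Finset.sum_eq_single_of_mem s (mem_univ s), hcs, one_smul]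
  intro l _ hl
  refine (hc l).elim (fun h0 => by rw [h0, zero_smul]) fun h1 => ?_
  have hpair := htrace ▸ Finset.add_le_sum (fun l _ => hnonneg l) (mem_univ s) (mem_univ l) hl.symm
  rw [hcs, h1, one_mul, one_mul] at hpair
  linarith [P.one_le_Q_zero s, P.one_le_Q_zero l]

theorem exists_Q_zero_eq_one_of_isBipartition {side : X → Prop} {T : Set (Fin (d + 1))}
    (hT : S.IsBipartition side T) : ∃ s, P.Q 0 s = 1 ∧ ∀ h, h ∈ T ↔ P.Q h s = -1 := by
  classical
  have hn := S.card_pos.ne'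
  let ε (h : Fin (d + 1)) : ℝ := if h ∈ T then -1 else 1
  let F : Matrix X X ℝ := (Fintype.card X : ℝ)⁻¹ • ∑ h, ε h • S.adj h
  let σ (x : X) : ℝ := if side x then 1 else -1
  have hF_rel (x y : X) : F x y = (Fintype.card X : ℝ)⁻¹ * ε (S.rel x y) := by
    simp [F, Matrix.sum_apply, AssociationScheme.adj]
  have hF (x y : X) : F x y = (Fintype.card X : ℝ)⁻¹ * (σ x * σ y) := by
    simp only [hF_rel, ε, hT x y]
    by_cases hx : side x <;> by_cases hy : side y <;> simp [σ, hx, hy]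
  have hσ (x : X) : σ x * σ x = 1 := by by_cases hx : side x <;> simp [σ, hx]
  have hmem : F ∈ Submodule.span ℝ (Set.range S.adj) :=
    Submodule.smul_mem _ _ (Submodule.sum_mem _ fun h _ =>
      Submodule.smul_mem _ _ (Submodule.subset_span ⟨h, rfl⟩))
  obtain ⟨c, hc⟩ := (Submodule.mem_span_range_iff_exists_fun ℝ).1 (P.mem_span hmem)
  have hidem : F * F = F := by
    ext x y
    have hterm (z : X) : F x z * F z y = (Fintype.card X : ℝ)⁻¹ * F x y := by
      rw [hF, hF, hF]
      linear_combination (Fintype.card X : ℝ)⁻¹ ^ 2 * (σ x * σ y) * hσ z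
    rw [Matrix.mul_apply, Finset.sum_congr rfl fun z _ => hterm z, Finset.sum_const, card_univ,
      nsmul_eq_mul, mul_inv_cancel_left₀ hn]
  have htrace : F.trace = 1 := by simp [Matrix.trace, hF, hσ, hn]
  rw [← hc] at hidem htrace
  obtain ⟨s, hs, hFs⟩ := P.eq_E_of_mul_self_of_trace_eq_one hidem htrace
  refine ⟨s, hs, fun h => ?_⟩
  obtain ⟨x, y, rfl⟩ := S.rel_nonempty h
  rw [P.Q_rel, ← hFs, hc, hF_rel, mul_inv_cancel_left₀ hn]
  by_cases hxy : S.rel x y ∈ T <;> norm_num [ε, hxy]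

end PrimitiveIdempotents

/-- The same scheme with the relations renumbered: the new `R_h` is the old `R_{e h}`. -/
def AssociationScheme.renumber {X : Type u} [Fintype X] {d : ℕ} (S : AssociationScheme X d)
    (e : Equiv.Perm (Fin (d + 1))) (he : e 0 = 0) : AssociationScheme X d where
  rel x y := e.symm (S.rel x y)
  rel_nonempty i := by simpa only [Equiv.symm_apply_eq] using S.rel_nonempty (e i)
  rel_eq_zero_iff x y := by rw [Equiv.symm_apply_eq, he, S.rel_eq_zero_iff]
  rel_symm x y := by rw [S.rel_symm]
  regular i j h := by simpa only [Equiv.symm_apply_eq] using S.regular (e i) (e j) (e h)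

theorem AssociationScheme.exists_graph_renumber_iff {X : Type u} [Fintype X] {d : ℕ}
    (S : AssociationScheme X d) (e : Equiv.Perm (Fin (d + 1))) (he : e 0 = 0)
    (p : SimpleGraph X → Prop) :
    (∃ (i : Fin (d + 1)) (hi : i ≠ 0), p ((S.renumber e he).graph i hi)) ↔
      ∃ (i : Fin (d + 1)) (hi : i ≠ 0), p (S.graph i hi) := by
  have hne (i : Fin (d + 1)) : i ≠ 0 ↔ e i ≠ 0 := by rw [← e.injective.ne_iff, he]
  have hgraph (i : Fin (d + 1)) (hi : i ≠ 0) (hei : e i ≠ 0) :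
      (S.renumber e he).graph i hi = S.graph (e i) hei := by
    ext x y
    exact e.symm_apply_eq
  refine e.exists_congr fun i =>
    ⟨fun ⟨hi, h⟩ => ⟨(hne i).1 hi, ?_⟩, fun ⟨hei, h⟩ => ⟨(hne i).2 hei, ?_⟩⟩
  · rwa [← hgraph i hi]
  · rwa [hgraph i _ hei]

namespace QPolynomialStructure

open Finset

section Renumber

variable {X : Type u} [Fintype X] [DecidableEq X] {d : ℕ}

/-- The same `Q`-polynomial structure on the renumbered scheme: the idempotents keep their order
and only the rows of the matrix of dual eigenvalues are permuted. -/
def renumber {S : AssociationScheme X d} (P : QPolynomialStructure S)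
    (e : Equiv.Perm (Fin (d + 1))) (he : e 0 = 0) : QPolynomialStructure (S.renumber e he) where
  E := P.E
  Q h := P.Q (e h)
  E_eq j := by
    have hadj (h : Fin (d + 1)) : (S.renumber e he).adj h = S.adj (e h) := by
      simp only [AssociationScheme.adj, AssociationScheme.renumber, Equiv.symm_apply_eq]
    simp only [hadj, Equiv.sum_comp e fun h => P.Q h j • S.adj h, P.E_eq]
  E_zero := P.E_zero
  E_ne_zero := P.E_ne_zero
  E_idem := P.E_idem
  E_orth := P.E_orth
  E_sum := P.E_sum
  isQPolynomial := P.isQPolynomial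

theorem isDualTight_renumber {S : AssociationScheme X (d + 2)} (P : QPolynomialStructure S)
    (e : Equiv.Perm (Fin (d + 3))) (he : e 0 = 0) :
    (P.renumber e he).IsDualTight ↔ P.IsDualTight := by
  have hm : (P.renumber e he).m = P.m := congrArg (P.Q · 1) he
  have hlast : (P.renumber e he).thetaLast = P.thetaLast := e.iInf_comp (g := P.dualEigenvalue)
  have hsecond : (P.renumber e he).thetaSecond = P.thetaSecond :=
    (e.subtypeEquiv fun h => not_congr (by rw [← e.apply_eq_iff_eq, he])).iSup_congr fun _ => rfl
  simp only [IsDualTight, hm, hlast, hsecond]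
  rfl

end Renumber

section General

variable {X : Type u} [Fintype X] [DecidableEq X] {d : ℕ} {S : AssociationScheme X d}
  (P : QPolynomialStructure S)

theorem krein_one_eq_zero_of_lt {j l : Fin (d + 1)} (hjl : (j : ℕ) + 1 < l) :
    P.krein 1 j l = 0 :=
  (P.isQPolynomial 1 j l).1 (Or.inl (by rw [Fin.val_one', Nat.mod_eq_of_lt] <;> lia))

theorem krein_one_ne_zero_of_eq_succ {j l : Fin (d + 1)} (hjl : (l : ℕ) = j + 1) :
    P.krein 1 j l ≠ 0 :=
  (P.isQPolynomial 1 j l).2 (Or.inl (by rw [Fin.val_one', Nat.mod_eq_of_lt] <;> lia))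

theorem Q_one_injective : Function.Injective fun h => P.Q h 1 := by
  intro h g (hone : P.Q h 1 = P.Q g 1)
  suffices hcol : ∀ n (hn : n < d + 1), P.Q h ⟨n, hn⟩ = P.Q g ⟨n, hn⟩ from
    P.Q_injective (funext fun j => hcol j j.2)
  intro n
  induction n using Nat.strong_induction_on with
  | _ n ih =>
    intro hn
    rcases n with _ | j
    · exact (P.Q_zero_right h).trans (P.Q_zero_right g).symm
    · have hj : j < d + 1 := by lia
      have hsum : ∑ l, P.krein 1 ⟨j, hj⟩ l * (P.Q h l - P.Q g l) = 0 := by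
        simp only [mul_sub, Finset.sum_sub_distrib, ← P.Q_mul_Q]
        rw [ih j (by lia), hone, sub_self]
      rw [Finset.sum_eq_single_of_mem ⟨j + 1, hn⟩ (mem_univ _)] at hsum
      · exact sub_eq_zero.1
          ((mul_eq_zero.1 hsum).resolve_left (P.krein_one_ne_zero_of_eq_succ rfl))
      · intro l _ hl
        rcases lt_or_gt_of_ne (fun hlj => hl (Fin.ext hlj) : (l : ℕ) ≠ j + 1) with hlt | hgt
        · rw [ih l hlt l.2, sub_self, mul_zero]
        · rw [P.krein_one_eq_zero_of_lt hgt, zero_mul]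

theorem exists_perm_strictAnti :
    ∃ e : Equiv.Perm (Fin (d + 1)), e 0 = 0 ∧ StrictAnti fun h => P.Q (e h) 1 := by
  let e := Tuple.sort fun h => -P.Q h 1
  have hanti : Antitone fun h => P.Q (e h) 1 := fun h g hhg =>
    neg_le_neg_iff.1 (Tuple.monotone_sort (fun h => -P.Q h 1) hhg)
  refine ⟨e, P.Q_one_injective (le_antisymm (P.Q_le_Q_zero _ 1) ?_),
    hanti.strictAnti_of_injective (P.Q_one_injective.comp e.injective)⟩
  simpa only [e.apply_symm_apply] using hanti (Fin.zero_le (e.symm 0))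

theorem Q_one_lt {h : Fin (d + 1)} (hh : h ≠ 0) : P.Q h 1 < P.Q 0 1 :=
  (P.Q_le_Q_zero h 1).lt_of_ne (P.Q_one_injective.ne hh)

theorem isQBipartite_of_Q_one_eq_neg {h : Fin (d + 1)} (hneg : P.Q h 1 = -P.Q 0 1) :
    P.IsQBipartite := by
  have hsign (j : ℕ) : ((-1 : ℝ) ^ j) ^ 2 = 1 := by rw [← pow_mul', pow_mul, neg_one_sq, one_pow]
  have hstep {j : ℕ} {l : Fin (d + 1)} (hj : j < d + 1)
      (hcol : P.Q h ⟨j, hj⟩ = (-1) ^ j * P.Q 0 ⟨j, hj⟩) (hl : P.krein 1 ⟨j, hj⟩ l ≠ 0) :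
      P.Q h l = (-1) ^ (j + 1) * P.Q 0 l := by
    rw [pow_succ']
    exact P.Q_eq_of_krein_ne_zero neg_one_sq (hsign j) (by rw [hneg, neg_one_mul]) hcol hl
  have hcol (j : ℕ) (hj : j < d + 1) : P.Q h ⟨j, hj⟩ = (-1) ^ j * P.Q 0 ⟨j, hj⟩ := by
    induction j with
    | zero => exact (P.Q_zero_right h).trans (by simpa using (P.Q_zero_right 0).symm)
    | succ j ih => exact hstep (by lia) (ih (by lia)) (P.krein_one_ne_zero_of_eq_succ rfl)
  intro j
  by_contra haj
  have hodd := hstep j.2 (hcol j j.2) haj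
  have hpos := mul_ne_zero (pow_ne_zero j (neg_ne_zero.2 one_ne_zero)) (P.Q_zero_pos j).ne'
  rw [hcol j j.2, pow_succ] at hodd
  exact hpos (by linear_combination hodd / 2)

theorem eq_last_of_Q_zero_eq_one {s : Fin (d + 1)} (hs : P.Q 0 s = 1) (hs0 : s ≠ 0) :
    s = Fin.last d := by
  by_contra hlast
  have hs_pos : 0 < (s : ℕ) := Nat.pos_of_ne_zero fun h0 => hs0 (Fin.ext h0)
  have hs_lt : (s : ℕ) < d := lt_of_le_of_ne (Nat.le_of_lt_succ s.2) fun hd => hlast (Fin.ext hd)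
  have hone : ((1 : Fin (d + 1)) : ℕ) = 1 := by rw [Fin.val_one', Nat.mod_eq_of_lt (by lia)]
  obtain ⟨p, hp⟩ : ∃ p : Fin (d + 1), (p : ℕ) + 1 = s :=
    ⟨⟨s - 1, by lia⟩, Nat.sub_add_cancel hs_pos⟩
  obtain ⟨q, hq⟩ : ∃ q : Fin (d + 1), (q : ℕ) = s + 1 := ⟨⟨s + 1, by lia⟩, rfl⟩
  have hkp : P.krein s p 1 = 1 := P.krein_eq_one_of_Q_zero_eq_one hs
    ((P.isQPolynomial s p 1).2 (Or.inr (Or.inl (by lia))))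
  have hkq : P.krein s q 1 = 1 := P.krein_eq_one_of_Q_zero_eq_one hs
    ((P.isQPolynomial s q 1).2 (Or.inr (Or.inr (by lia))))
  have hpq : p ≠ q := by rintro rfl; lia
  have hsum := (Finset.add_le_sum (fun l _ => P.krein_nonneg s l 1) (mem_univ p) (mem_univ q)
    hpq).trans_eq (P.sum_krein s 1)
  linarith

end General

section Sorted

variable {X : Type u} [Fintype X] [DecidableEq X] {d : ℕ} {S : AssociationScheme X (d + 1)}
  {P : QPolynomialStructure S}

theorem thetaSecond_eq (hθ : StrictAnti fun h => P.Q h 1) : P.thetaSecond = P.Q 1 1 := by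
  let one : {h : Fin (d + 2) // h ≠ 0} := ⟨1, one_ne_zero⟩
  have : Nonempty {h : Fin (d + 2) // h ≠ 0} := ⟨one⟩
  exact le_antisymm (ciSup_le fun h => hθ.antitone (Fin.one_le_of_ne_zero h.2))
    (le_ciSup (f := fun h : {h : Fin (d + 2) // h ≠ 0} => P.dualEigenvalue h)
      (Set.finite_range _).bddAbove one)

theorem thetaLast_eq (hθ : StrictAnti fun h => P.Q h 1) :
    P.thetaLast = P.Q (Fin.last (d + 1)) 1 :=
  le_antisymm (ciInf_le (Set.finite_range P.dualEigenvalue).bddBelow _)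
    (le_ciInf fun h => hθ.antitone h.le_last)

end Sorted

section ClassThree

variable {X : Type u} [Fintype X] [DecidableEq X] {S : AssociationScheme X 3}
  (P : QPolynomialStructure S)

theorem krein_one_two_one_pos : 0 < P.krein 1 2 1 :=
  (P.krein_nonneg 1 2 1).lt_of_ne' ((P.isQPolynomial 1 2 1).2 (by decide))

theorem krein_one_one_two_pos : 0 < P.krein 1 1 2 :=
  (P.krein_nonneg 1 1 2).lt_of_ne' ((P.isQPolynomial 1 1 2).2 (by decide))

theorem krein_one_three_two_pos : 0 < P.krein 1 3 2 :=
  (P.krein_nonneg 1 3 2).lt_of_ne' ((P.isQPolynomial 1 3 2).2 (by decide))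

theorem one_add_krein : 1 + P.krein 1 1 1 + P.krein 1 2 1 = P.Q 0 1 := by
  have hsum := P.sum_krein 1 1
  rw [Fin.sum_univ_four, P.krein_zero_mid, if_pos rfl,
    (P.isQPolynomial 1 3 1).1 (by decide)] at hsum
  linear_combination hsum

theorem krein_one_two_sum : P.krein 1 1 2 + P.krein 1 2 2 + P.krein 1 3 2 = P.Q 0 1 := by
  have hsum := P.sum_krein 1 2
  rw [Fin.sum_univ_four, P.krein_zero_mid, if_neg (by decide)] at hsum
  linear_combination hsum

theorem krein_one_three_sum : P.krein 1 2 3 + P.krein 1 3 3 = P.Q 0 1 := by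
  have hsum := P.sum_krein 1 3
  rw [Fin.sum_univ_four, P.krein_zero_mid, if_neg (by decide),
    (P.isQPolynomial 1 1 3).1 (by decide)] at hsum
  linear_combination hsum

theorem krein_one_one_two_mul : P.krein 1 1 2 * P.Q 0 2 = P.krein 1 2 1 * P.Q 0 1 := by
  rw [P.krein_mul_rotate, P.krein_comm]

theorem krein_one_two_three_mul : P.krein 1 2 3 * P.Q 0 3 = P.krein 1 3 2 * P.Q 0 2 := by
  rw [P.krein_comm, P.krein_mul_rotate, P.krein_comm]

theorem Q_one_mul_Q_one (h : Fin 4) :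
    P.Q h 1 * P.Q h 1 = P.Q 0 1 + P.krein 1 1 1 * P.Q h 1 + P.krein 1 1 2 * P.Q h 2 := by
  rw [P.Q_mul_Q, Fin.sum_univ_four, P.krein_self_zero, P.Q_zero_right,
    (P.isQPolynomial 1 1 3).1 (by decide)]
  ring

theorem Q_one_mul_Q_two (h : Fin 4) : P.Q h 1 * P.Q h 2 =
    P.krein 1 2 1 * P.Q h 1 + P.krein 1 2 2 * P.Q h 2 + P.krein 1 2 3 * P.Q h 3 := by
  rw [P.Q_mul_Q, Fin.sum_univ_four, (P.isQPolynomial 1 2 0).1 (by decide)]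
  ring

theorem one_add_Q_sum {h : Fin 4} (hh : h ≠ 0) : 1 + P.Q h 1 + P.Q h 2 + P.Q h 3 = 0 := by
  have hsum := P.sum_Q h
  rwa [Fin.sum_univ_four, P.Q_zero_right, if_neg hh] at hsum

theorem Q_one_cubic {h : Fin 4} (hh : h ≠ 0) :
    P.Q h 1 ^ 3 + (P.krein 1 2 3 - P.krein 1 2 2 - P.krein 1 1 1) * P.Q h 1 ^ 2 +
      (P.krein 1 1 2 * (P.krein 1 2 3 - P.krein 1 2 1) - P.Q 0 1 -
        P.krein 1 1 1 * (P.krein 1 2 3 - P.krein 1 2 2)) * P.Q h 1 +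
      (P.krein 1 1 2 * P.krein 1 2 3 - P.Q 0 1 * (P.krein 1 2 3 - P.krein 1 2 2)) = 0 := by
  linear_combination (P.Q h 1 + P.krein 1 2 3 - P.krein 1 2 2) * P.Q_one_mul_Q_one h +
    P.krein 1 1 2 * P.Q_one_mul_Q_two h + P.krein 1 1 2 * P.krein 1 2 3 * P.one_add_Q_sum hh

/-- The slack in the dual fundamental bound for the pair `θ_i`, `θ_j`, up to a positive factor:
`(a₁ + 1) θ_i θ_j + m (θ_i + θ_j) + m (b₁ + 1)`. -/
noncomputable def tightDefect (i j : Fin 4) : ℝ :=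
  (P.krein 1 1 1 + 1) * (P.Q i 1 * P.Q j 1) + P.Q 0 1 * (P.Q i 1 + P.Q j 1) +
    P.Q 0 1 * (P.krein 1 2 1 + 1)

variable {P} in
theorem isDualTight_iff (hθ : StrictAnti fun h => P.Q h 1) :
    P.IsDualTight ↔ ¬P.IsQBipartite ∧ P.tightDefect 1 3 = 0 := by
  have ha : P.krein 1 1 1 + 1 ≠ 0 := by linarith [P.krein_nonneg 1 1 1]
  rw [IsDualTight, thetaSecond_eq hθ, thetaLast_eq hθ]
  refine and_congr_right fun _ => ?_
  change (P.Q 1 1 + P.Q 0 1 / (P.krein 1 1 1 + 1)) * (P.Q 3 1 + P.Q 0 1 / (P.krein 1 1 1 + 1)) =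
    -(P.Q 0 1 * P.krein 1 1 1 * P.krein 1 2 1 / (P.krein 1 1 1 + 1) ^ 2) ↔ _
  rw [eq_neg_iff_add_eq_zero, show
    (P.Q 1 1 + P.Q 0 1 / (P.krein 1 1 1 + 1)) * (P.Q 3 1 + P.Q 0 1 / (P.krein 1 1 1 + 1)) +
      P.Q 0 1 * P.krein 1 1 1 * P.krein 1 2 1 / (P.krein 1 1 1 + 1) ^ 2 =
    P.tightDefect 1 3 / (P.krein 1 1 1 + 1) by
    rw [tightDefect, ← P.one_add_krein]
    field_simp
    ring, div_eq_zero_iff, or_iff_left ha]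

/-- The unnormalized variance of the dual eigenvalue `θ_{yz}` over `y ∈ R_i(x)`, `z ∈ R_j(x)`, the
mean being `θ_i θ_j / m`. -/
theorem sum_sum_sq_sub (i j : Fin 4) (x : X) :
    ∑ y with S.rel x y = i, ∑ z with S.rel x z = j,
        (P.Q (S.rel y z) 1 - P.Q i 1 * P.Q j 1 / P.Q 0 1) ^ 2 =
      S.valency i * S.valency j * (P.tightDefect i j *
        ((P.Q 0 1 - P.Q i 1) * (P.Q 0 1 - P.Q j 1)) / (P.krein 1 2 1 * P.Q 0 1 ^ 2)) := by
  have hm := (P.Q_zero_pos 1).ne'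
  have hm₂ := (P.Q_zero_pos 2).ne'
  have hb := P.krein_one_two_one_pos.ne'
  have hc := P.krein_one_one_two_pos.ne'
  set τ := P.Q i 1 * P.Q j 1 / P.Q 0 1 with hτ
  have hterm (y z : X) : (P.Q (S.rel y z) 1 - τ) ^ 2 =
      (P.Q 0 1 + τ ^ 2) * P.Q (S.rel y z) 0 + (P.krein 1 1 1 - 2 * τ) * P.Q (S.rel y z) 1 +
        P.krein 1 1 2 * P.Q (S.rel y z) 2 := by
    rw [P.Q_zero_right]
    linear_combination P.Q_one_mul_Q_one (S.rel y z)
  have hQ₂ : P.krein 1 1 2 * (P.Q i 2 * P.Q j 2 / P.Q 0 2) =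
      (P.Q i 1 * P.Q i 1 - P.Q 0 1 - P.krein 1 1 1 * P.Q i 1) *
        (P.Q j 1 * P.Q j 1 - P.Q 0 1 - P.krein 1 1 1 * P.Q j 1) / (P.krein 1 2 1 * P.Q 0 1) := by
    rw [← P.krein_one_one_two_mul, P.Q_one_mul_Q_one i, P.Q_one_mul_Q_one j]
    field_simp
    ring
  simp only [hterm, Finset.sum_add_distrib, ← Finset.mul_sum, P.sum_sum_rel_Q]
  rw [P.Q_zero_right, P.Q_zero_right, P.Q_zero_right, mul_left_comm (P.krein 1 1 2), hQ₂, hτ,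
    tightDefect, show P.krein 1 1 1 = P.Q 0 1 - 1 - P.krein 1 2 1 by linarith [P.one_add_krein]]
  field_simp
  ring

theorem Q_rel_eq_of_tightDefect_eq_zero {i j : Fin 4} (htight : P.tightDefect i j = 0) {x y z : X}
    (hy : S.rel x y = i) (hz : S.rel x z = j) :
    P.Q (S.rel y z) 1 = P.Q i 1 * P.Q j 1 / P.Q 0 1 := by
  have hvar := P.sum_sum_sq_sub i j x
  rw [htight, zero_mul, zero_div, mul_zero, Finset.sum_eq_zero_iff_of_nonneg fun y _ =>
    Finset.sum_nonneg fun z _ => sq_nonneg _] at hvar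
  have hvar_y := hvar y (by simp [hy])
  rw [Finset.sum_eq_zero_iff_of_nonneg fun z _ => sq_nonneg _] at hvar_y
  exact sub_eq_zero.1 (sq_eq_zero_iff.1 (hvar_y z (by simp [hz])))

theorem valency_two_mul : S.valency 2 *
      ((P.Q 2 1 - P.Q 0 1) * (P.Q 2 1 - P.Q 1 1) * (P.Q 2 1 - P.Q 3 1)) =
    -(Fintype.card X * P.Q 0 1 * (P.krein 1 2 1 + (1 + P.Q 1 1) * (1 + P.Q 3 1))) := by
  have h₀₀ := P.sum_valency_mul_Q_mul_Q 0 0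
  have h₁₀ := P.sum_valency_mul_Q_mul_Q 1 0
  have h₁₁ := P.sum_valency_mul_Q_mul_Q 1 1
  have h₁₁₁ := P.krein_mul 1 1 1
  rw [Fin.sum_univ_four] at h₀₀ h₁₀ h₁₁ h₁₁₁
  simp only [P.Q_zero_right, S.valency_zero, Nat.cast_one, one_mul, mul_one, if_true,
    if_neg (one_ne_zero : (1 : Fin 4) ≠ 0)] at h₀₀ h₁₀ h₁₁ h₁₁₁
  linear_combination -h₁₁₁ - (P.Q 0 1 + P.Q 1 1 + P.Q 3 1) * h₁₁ +
    (P.Q 0 1 * P.Q 1 1 + P.Q 0 1 * P.Q 3 1 + P.Q 1 1 * P.Q 3 1) * h₁₀ -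
    P.Q 0 1 * P.Q 1 1 * P.Q 3 1 * h₀₀ + Fintype.card X * P.Q 0 1 * P.one_add_krein

theorem Q_one_vieta :
    P.krein 1 2 3 - P.krein 1 2 2 - P.krein 1 1 1 = -(P.Q 1 1 + P.Q 2 1 + P.Q 3 1) ∧
    P.krein 1 1 2 * (P.krein 1 2 3 - P.krein 1 2 1) - P.Q 0 1 -
        P.krein 1 1 1 * (P.krein 1 2 3 - P.krein 1 2 2) =
      P.Q 1 1 * P.Q 2 1 + P.Q 1 1 * P.Q 3 1 + P.Q 2 1 * P.Q 3 1 ∧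
    P.krein 1 1 2 * P.krein 1 2 3 - P.Q 0 1 * (P.krein 1 2 3 - P.krein 1 2 2) =
      -(P.Q 1 1 * P.Q 2 1 * P.Q 3 1) :=
  cubic_vieta (P.Q_one_injective.ne (by decide)) (P.Q_one_injective.ne (by decide))
    (P.Q_one_injective.ne (by decide)) (P.Q_one_cubic (by decide)) (P.Q_one_cubic (by decide))
    (P.Q_one_cubic (by decide))

section Tight

variable {P}

theorem krein_one_one_one_pos_of_isDualTight (hθ : StrictAnti fun h => P.Q h 1)
    (hP : P.IsDualTight) : 0 < P.krein 1 1 1 := by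
  obtain ⟨hbip, htight⟩ := (isDualTight_iff hθ).1 hP
  refine (P.krein_nonneg 1 1 1).lt_of_ne' fun ha => hbip ?_
  have hprod : (P.Q 1 1 + P.Q 0 1) * (P.Q 3 1 + P.Q 0 1) = 0 := by
    rw [tightDefect] at htight
    linear_combination htight - P.Q 0 1 * P.one_add_krein + (P.Q 0 1 - P.Q 1 1 * P.Q 3 1) * ha
  exact (mul_eq_zero.1 hprod).elim
    (fun h => P.isQBipartite_of_Q_one_eq_neg (eq_neg_of_add_eq_zero_left h))
    fun h => P.isQBipartite_of_Q_one_eq_neg (eq_neg_of_add_eq_zero_left h)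

theorem Q_one_mul_Q_three_neg (hθ : StrictAnti fun h => P.Q h 1) (htight : P.tightDefect 1 3 = 0) :
    P.Q 1 1 * P.Q 3 1 < 0 := by
  have hlt : P.krein 1 2 1 + (1 + P.Q 1 1) * (1 + P.Q 3 1) < 0 := by
    have h20 := sub_neg.2 (hθ (show (0 : Fin 4) < 2 by decide))
    have h21 := sub_neg.2 (hθ (show (1 : Fin 4) < 2 by decide))
    have h23 := sub_pos.2 (hθ (show (2 : Fin 4) < 3 by decide))
    have hpos := mul_pos (Nat.cast_pos.2 (S.valency_pos 2))
      (mul_pos (mul_pos_of_neg_of_neg h20 h21) h23)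
    rw [P.valency_two_mul] at hpos
    exact neg_of_mul_neg_right (neg_pos.1 hpos) (mul_pos S.card_pos (P.Q_zero_pos 1)).le
  refine neg_of_mul_neg_right (a := P.krein 1 2 1) ?_ P.krein_one_two_one_pos.le
  rw [tightDefect] at htight
  linarith [mul_neg_of_pos_of_neg (P.Q_zero_pos 1) hlt,
    congrArg (· * (P.Q 1 1 * P.Q 3 1)) P.one_add_krein]

/-- Only `R_2` can carry the constant value `θ_1 θ_3 / m` of `Q_rel_eq_of_tightDefect_eq_zero`. -/
theorem Q_zero_mul_Q_two (hθ : StrictAnti fun h => P.Q h 1) (htight : P.tightDefect 1 3 = 0) :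
    P.Q 0 1 * P.Q 2 1 = P.Q 1 1 * P.Q 3 1 := by
  have hneg := Q_one_mul_Q_three_neg hθ htight
  obtain ⟨x, -⟩ := S.rel_nonempty 0
  obtain ⟨y, hy⟩ := S.exists_rel 1 x
  obtain ⟨z, hz⟩ := S.exists_rel 3 x
  have hyz := P.Q_rel_eq_of_tightDefect_eq_zero htight hy hz
  rw [eq_div_iff (P.Q_zero_pos 1).ne', mul_comm] at hyz
  have h1 : P.Q 1 1 < P.Q 0 1 := P.Q_one_lt (by decide)
  have h3 : P.Q 3 1 < P.Q 0 1 := P.Q_one_lt (by decide)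
  generalize S.rel y z = g at hyz
  fin_cases g
  · exact absurd hyz (hneg.trans_le (mul_self_nonneg (P.Q 0 1))).ne'
  · rw [mul_comm] at hyz
    exact absurd (mul_left_cancel₀ (left_ne_zero_of_mul hneg.ne) hyz) h3.ne'
  · exact hyz
  · exact absurd (mul_right_cancel₀ (right_ne_zero_of_mul hneg.ne) hyz) h1.ne'

theorem krein_eq_of_tightDefect_eq_zero (htight : P.tightDefect 1 3 = 0)
    (hθ₂ : P.Q 0 1 * P.Q 2 1 = P.Q 1 1 * P.Q 3 1) :
    P.krein 1 1 2 = P.Q 0 1 + P.krein 1 1 1 * P.Q 2 1 - P.Q 2 1 ^ 2 ∧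
      P.krein 1 2 2 = -(P.krein 1 1 1 * P.Q 2 1) ∧ P.krein 1 3 2 = P.Q 2 1 ^ 2 ∧
      P.krein 1 2 3 = P.Q 0 1 := by
  obtain ⟨hsum, hpairs, hprod⟩ := P.Q_one_vieta
  have hm := P.one_add_krein
  have hθ₁₃ : P.Q 1 1 + P.Q 3 1 = -((P.krein 1 1 1 + 1) * P.Q 2 1 + (P.krein 1 2 1 + 1)) := by
    apply mul_left_cancel₀ (P.Q_zero_pos 1).ne'
    rw [tightDefect] at htight
    linear_combination htight + (P.krein 1 1 1 + 1) * hθ₂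
  have hc₃ : P.krein 1 2 3 - P.krein 1 2 2 = P.Q 0 1 + P.krein 1 1 1 * P.Q 2 1 := by
    linear_combination hsum - hθ₁₃ + hm
  have hc₂c₃ : P.krein 1 1 2 * P.krein 1 2 3 =
      P.Q 0 1 * (P.Q 0 1 + P.krein 1 1 1 * P.Q 2 1 - P.Q 2 1 ^ 2) := by
    linear_combination hprod + P.Q 0 1 * hc₃ + P.Q 2 1 * hθ₂
  have hc₂ : P.krein 1 1 2 = P.Q 0 1 + P.krein 1 1 1 * P.Q 2 1 - P.Q 2 1 ^ 2 := by
    apply mul_left_cancel₀ P.krein_one_two_one_pos.ne'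
    linear_combination hc₂c₃ - hpairs - P.krein 1 1 1 * hc₃ + hθ₂ - P.Q 2 1 * hθ₁₃ +
      (P.Q 2 1 - P.Q 0 1 - P.krein 1 1 1 * P.Q 2 1 + P.Q 2 1 ^ 2) * hm
  have hc₃' : P.krein 1 2 3 = P.Q 0 1 := by
    apply mul_left_cancel₀ P.krein_one_one_two_pos.ne'
    linear_combination hc₂c₃ - P.Q 0 1 * hc₂
  have ha₂ : P.krein 1 2 2 = -(P.krein 1 1 1 * P.Q 2 1) := by linear_combination hc₃' - hc₃
  exact ⟨hc₂, ha₂, by linear_combination P.krein_one_two_sum - hc₂ - ha₂, hc₃'⟩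

theorem Q_two_of_tightDefect_eq_zero (htight : P.tightDefect 1 3 = 0)
    (hθ₂ : P.Q 0 1 * P.Q 2 1 = P.Q 1 1 * P.Q 3 1) : P.Q 2 2 = -1 ∧ P.Q 2 3 = -P.Q 2 1 := by
  obtain ⟨hc₂, -⟩ := krein_eq_of_tightDefect_eq_zero htight hθ₂
  have h22 : P.Q 2 2 = -1 := by
    apply mul_left_cancel₀ P.krein_one_one_two_pos.ne'
    linear_combination hc₂ - P.Q_one_mul_Q_one 2
  exact ⟨h22, by linear_combination P.one_add_Q_sum (h := 2) (by decide) - h22⟩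

theorem krein_mul_Q_zero_three (htight : P.tightDefect 1 3 = 0)
    (hθ₂ : P.Q 0 1 * P.Q 2 1 = P.Q 1 1 * P.Q 3 1) :
    P.krein 1 1 2 * P.Q 0 3 = P.Q 2 1 ^ 2 * P.krein 1 2 1 := by
  obtain ⟨-, -, hb₂, hc₃⟩ := krein_eq_of_tightDefect_eq_zero htight hθ₂
  have h3 := P.krein_one_two_three_mul
  rw [hc₃, hb₂] at h3
  apply mul_left_cancel₀ (P.Q_zero_pos 1).ne'
  linear_combination P.krein 1 1 2 * h3 + P.Q 2 1 ^ 2 * P.krein_one_one_two_mul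

theorem Q_two_one_neg (ha : 0 < P.krein 1 1 1) (htight : P.tightDefect 1 3 = 0)
    (hθ₂ : P.Q 0 1 * P.Q 2 1 = P.Q 1 1 * P.Q 3 1) : P.Q 2 1 < 0 := by
  obtain ⟨-, ha₂, hb₂, -⟩ := krein_eq_of_tightDefect_eq_zero htight hθ₂
  have ht₀ : P.Q 2 1 ≠ 0 := fun h0 =>
    P.krein_one_three_two_pos.ne' (by rw [hb₂, h0, zero_pow two_ne_zero])
  refine lt_of_le_of_ne (not_lt.1 fun hpos => ?_) ht₀
  linarith [P.krein_nonneg 1 2 2, mul_pos ha hpos]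

theorem Q_two_one_le_neg_one (ha : 0 < P.krein 1 1 1) (htight : P.tightDefect 1 3 = 0)
    (hθ₂ : P.Q 0 1 * P.Q 2 1 = P.Q 1 1 * P.Q 3 1) : P.Q 2 1 ≤ -1 := by
  obtain ⟨hc₂, -⟩ := krein_eq_of_tightDefect_eq_zero htight hθ₂
  have ht := Q_two_one_neg ha htight hθ₂
  have h23 : -P.Q 2 1 ≤ P.Q 0 3 :=
    (Q_two_of_tightDefect_eq_zero htight hθ₂).2 ▸ P.Q_le_Q_zero 2 3
  have hle : -P.Q 2 1 * (P.krein 1 1 2 + P.Q 2 1 * P.krein 1 2 1) ≤ 0 := by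
    linarith [mul_le_mul_of_nonneg_left h23 P.krein_one_one_two_pos.le,
      krein_mul_Q_zero_three htight hθ₂]
  have hfactor : P.krein 1 1 2 + P.Q 2 1 * P.krein 1 2 1 =
      (P.Q 0 1 - P.Q 2 1) * (1 + P.Q 2 1) := by
    linear_combination hc₂ + P.Q 2 1 * P.one_add_krein
  have hlt : 0 < P.Q 0 1 - P.Q 2 1 := sub_pos.2 (P.Q_one_lt (by decide))
  rw [hfactor] at hle
  linarith [nonpos_of_mul_nonpos_right (nonpos_of_mul_nonpos_right hle (neg_pos.2 ht)) hlt]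

theorem krein_mul_krein_three (ht₀ : P.Q 2 1 ≠ 0) (htight : P.tightDefect 1 3 = 0)
    (hθ₂ : P.Q 0 1 * P.Q 2 1 = P.Q 1 1 * P.Q 3 1) :
    P.krein 1 1 2 * P.krein 3 3 3 = -(P.krein 1 1 1 * P.Q 2 1 * (1 + P.Q 2 1)) := by
  obtain ⟨hc₂, -, -, hc₃⟩ := krein_eq_of_tightDefect_eq_zero htight hθ₂
  obtain ⟨h22, h23⟩ := Q_two_of_tightDefect_eq_zero htight hθ₂
  have hm₃ := krein_mul_Q_zero_three htight hθ₂
  have h331 : P.krein 3 3 1 = 0 := by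
    have hrot := P.krein_mul_rotate 3 3 1
    rw [show P.krein 1 3 3 = 0 by linear_combination P.krein_one_three_sum - hc₃,
      zero_mul] at hrot
    exact (mul_eq_zero.1 hrot).resolve_right (P.Q_zero_pos 1).ne'
  have hrow (h : Fin 4) : P.Q h 3 * P.Q h 3 =
      P.Q 0 3 + P.krein 3 3 2 * P.Q h 2 + P.krein 3 3 3 * P.Q h 3 := by
    rw [P.Q_mul_Q, Fin.sum_univ_four, P.krein_self_zero, P.Q_zero_right, h331]
    ring
  have h0 := hrow 0
  have h2 := hrow 2
  rw [h22, h23] at h2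
  have hlt : P.Q 2 1 - P.Q 0 1 < 0 := sub_neg.2 (P.Q_one_lt (by decide))
  apply mul_left_cancel₀ (mul_ne_zero (mul_ne_zero P.krein_one_two_one_pos.ne' ht₀) hlt.ne)
  -- `h0 + P.Q 0 2 * h2` eliminates `P.krein 3 3 2`.
  linear_combination -P.krein 1 1 2 ^ 2 * (h0 + P.Q 0 2 * h2) +
    (P.krein 1 1 2 * P.Q 0 3 + P.Q 2 1 ^ 2 * P.krein 1 2 1 - P.krein 1 1 2 -
      P.krein 1 2 1 * P.Q 0 1 - P.krein 3 3 3 * P.krein 1 1 2) * hm₃ +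
    P.krein 1 1 2 * (P.Q 2 1 ^ 2 - P.Q 0 3 + P.krein 3 3 3 * P.Q 2 1) *
      P.krein_one_one_two_mul +
    P.krein 1 2 1 * P.Q 2 1 ^ 2 * ((P.Q 0 1 - 1) * hc₂ -
      (P.Q 0 1 - P.Q 2 1 ^ 2) * P.one_add_krein)

theorem neg_one_le_Q_two_one (ha : 0 < P.krein 1 1 1) (htight : P.tightDefect 1 3 = 0)
    (hθ₂ : P.Q 0 1 * P.Q 2 1 = P.Q 1 1 * P.Q 3 1) : -1 ≤ P.Q 2 1 := by
  have ht := Q_two_one_neg ha htight hθ₂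
  have hnonneg := mul_nonneg P.krein_one_one_two_pos.le (P.krein_nonneg 3 3 3)
  rw [krein_mul_krein_three ht.ne htight hθ₂, ← neg_mul, neg_mul_eq_mul_neg] at hnonneg
  linarith [nonneg_of_mul_nonneg_right hnonneg (mul_pos ha (neg_pos.2 ht))]

theorem Q_zero_three_of_isDualTight (hθ : StrictAnti fun h => P.Q h 1) (hP : P.IsDualTight) :
    P.Q 0 3 = 1 := by
  have ha := krein_one_one_one_pos_of_isDualTight hθ hP
  have htight := ((isDualTight_iff hθ).1 hP).2
  have hθ₂ := Q_zero_mul_Q_two hθ htight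
  have ht : P.Q 2 1 = -1 :=
    le_antisymm (Q_two_one_le_neg_one ha htight hθ₂) (neg_one_le_Q_two_one ha htight hθ₂)
  have hc₂ := (krein_eq_of_tightDefect_eq_zero htight hθ₂).1
  have hm₃ := krein_mul_Q_zero_three htight hθ₂
  rw [ht] at hc₂ hm₃
  apply mul_left_cancel₀ P.krein_one_one_two_pos.ne'
  linear_combination hm₃ - hc₂ + P.one_add_krein

end Tight

section Bipartite

variable {P}

theorem krein_of_Q_zero_three_eq_one (hs : P.Q 0 3 = 1) :
    P.krein 1 3 2 = 1 ∧ P.krein 1 3 3 = 0 ∧ P.krein 1 1 2 = P.krein 1 2 1 := by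
  have hb₂ : P.krein 1 3 2 = 1 := by
    have hne := P.krein_one_three_two_pos.ne'
    rw [P.krein_comm] at hne ⊢
    exact P.krein_eq_one_of_Q_zero_eq_one hs hne
  have ha₃ : P.krein 1 3 3 = 0 := by
    have hrot := P.krein_mul_rotate 1 3 3
    rwa [P.krein_self_of_Q_zero_eq_one hs one_ne_zero, zero_mul, hs, mul_one] at hrot
  refine ⟨hb₂, ha₃, mul_right_cancel₀ (P.Q_zero_pos 1).ne' ?_⟩
  have hm₂ : P.Q 0 2 = P.Q 0 1 := by
    linear_combination P.krein_one_three_sum - ha₃ - P.krein_one_two_three_mul +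
      P.krein 1 2 3 * hs - P.Q 0 2 * hb₂
  rw [← P.krein_one_one_two_mul, hm₂]

theorem Q_one_mul_Q_three (hs : P.Q 0 3 = 1) (h : Fin 4) : P.Q h 1 * P.Q h 3 = P.Q h 2 := by
  obtain ⟨hb₂, ha₃, -⟩ := krein_of_Q_zero_three_eq_one hs
  rw [P.Q_mul_Q, Fin.sum_univ_four, hb₂, ha₃, (P.isQPolynomial 1 3 0).1 (by decide),
    (P.isQPolynomial 1 3 1).1 (by decide)]
  ring

theorem Q_one_eq_neg_one_of_Q_three_ne (hs : P.Q 0 3 = 1) {h : Fin 4} (hh : h ≠ 0)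
    (hh3 : P.Q h 3 ≠ -1) : P.Q h 1 = -1 := by
  have hmul : (1 + P.Q h 1) * (1 + P.Q h 3) = 0 := by
    linear_combination P.one_add_Q_sum hh + Q_one_mul_Q_three hs h
  have hne : 1 + P.Q h 3 ≠ 0 := fun h0 => hh3 (eq_neg_of_add_eq_zero_right h0)
  exact eq_neg_of_add_eq_zero_right ((mul_eq_zero.1 hmul).resolve_right hne)

theorem Q_one_mul_self_of_Q_zero_three_eq_one (hs : P.Q 0 3 = 1) (h : Fin 4) :
    P.Q h 1 * P.Q h 1 = P.Q 0 1 + (P.krein 1 1 1 + P.krein 1 2 1 * P.Q h 3) * P.Q h 1 := by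
  obtain ⟨-, -, hc₂⟩ := krein_of_Q_zero_three_eq_one hs
  linear_combination P.Q_one_mul_Q_one h + P.Q h 2 * hc₂ -
    P.krein 1 2 1 * Q_one_mul_Q_three hs h

theorem Q_one_add_and_mul (hs : P.Q 0 3 = 1) {i j : Fin 4} (hij : i ≠ j) (hi : P.Q i 3 = -1)
    (hj : P.Q j 3 = -1) :
    P.Q i 1 + P.Q j 1 = P.krein 1 1 1 - P.krein 1 2 1 ∧ P.Q i 1 * P.Q j 1 = -P.Q 0 1 := by
  have hi' := Q_one_mul_self_of_Q_zero_three_eq_one hs i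
  have hj' := Q_one_mul_self_of_Q_zero_three_eq_one hs j
  rw [hi] at hi'
  rw [hj] at hj'
  have hadd : P.Q i 1 + P.Q j 1 = P.krein 1 1 1 - P.krein 1 2 1 :=
    mul_left_cancel₀ (sub_ne_zero.2 (P.Q_one_injective.ne hij)) (by linear_combination hi' - hj')
  exact ⟨hadd, by linear_combination P.Q i 1 * hadd - hi'⟩

theorem tightDefect_eq_zero_of_Q_three_eq_neg_one (hs : P.Q 0 3 = 1) {i j : Fin 4} (hij : i ≠ j)
    (hi : P.Q i 3 = -1) (hj : P.Q j 3 = -1) : P.tightDefect i j = 0 := by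
  obtain ⟨hadd, hmul⟩ := Q_one_add_and_mul hs hij hi hj
  rw [tightDefect]
  linear_combination (P.krein 1 1 1 + 1) * hmul + P.Q 0 1 * hadd

theorem one_add_Q_one_mul_neg (hs : P.Q 0 3 = 1) {i j : Fin 4} (hij : i ≠ j)
    (hi : P.Q i 3 = -1) (hj : P.Q j 3 = -1) : (1 + P.Q i 1) * (1 + P.Q j 1) < 0 := by
  obtain ⟨hadd, hmul⟩ := Q_one_add_and_mul hs hij hi hj
  linarith [P.one_add_krein, P.krein_one_two_one_pos]

theorem one_add_Q_one_mul_nonpos (hs : P.Q 0 3 = 1) {i j : Fin 4} (hi0 : i ≠ 0) (hj0 : j ≠ 0)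
    (hij : i ≠ j) : (1 + P.Q i 1) * (1 + P.Q j 1) ≤ 0 := by
  by_cases hi : P.Q i 3 = -1
  · by_cases hj : P.Q j 3 = -1
    · exact (one_add_Q_one_mul_neg hs hij hi hj).le
    · rw [Q_one_eq_neg_one_of_Q_three_ne hs hj0 hj, add_neg_cancel, mul_zero]
  · rw [Q_one_eq_neg_one_of_Q_three_ne hs hi0 hi, add_neg_cancel, zero_mul]

theorem Q_two_one_of_Q_zero_three_eq_one (hθ : StrictAnti fun h => P.Q h 1) (hs : P.Q 0 3 = 1) :
    P.Q 2 1 = -1 := by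
  have h12 : P.Q 2 1 < P.Q 1 1 := hθ (by decide)
  have h23 : P.Q 3 1 < P.Q 2 1 := hθ (by decide)
  rcases lt_trichotomy (P.Q 2 1) (-1) with h | h | h
  · exact absurd (one_add_Q_one_mul_nonpos hs (i := 2) (j := 3) (by decide) (by decide)
      (by decide)) (mul_pos_of_neg_of_neg (by linarith) (by linarith)).not_ge
  · exact h
  · exact absurd (one_add_Q_one_mul_nonpos hs (i := 1) (j := 2) (by decide) (by decide)
      (by decide)) (mul_pos (by linarith) (by linarith)).not_ge

theorem Q_three_of_Q_zero_three_eq_one (hθ : StrictAnti fun h => P.Q h 1) (hs : P.Q 0 3 = 1) :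
    P.Q 1 3 = -1 ∧ P.Q 2 3 = 1 ∧ P.Q 3 3 = -1 := by
  have h21 := Q_two_one_of_Q_zero_three_eq_one hθ hs
  have hsign (h : Fin 4) (hh : h ≠ 0) (hh2 : h ≠ 2) : P.Q h 3 = -1 := by
    by_contra hne
    exact P.Q_one_injective.ne hh2 ((Q_one_eq_neg_one_of_Q_three_ne hs hh hne).trans h21.symm)
  have h13 := hsign 1 (by decide) (by decide)
  refine ⟨h13, ?_, hsign 3 (by decide) (by decide)⟩
  refine (sq_eq_one_iff.1 (P.Q_sq_of_Q_zero_eq_one hs 2)).resolve_right fun h23 => ?_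
  have hneg := one_add_Q_one_mul_neg hs (by decide) h13 h23
  rw [h21, add_neg_cancel, mul_zero] at hneg
  exact hneg.false

theorem valency_one_add_valency_three (hθ : StrictAnti fun h => P.Q h 1) (hs : P.Q 0 3 = 1) :
    S.valency 1 + S.valency 3 = S.valency 2 + 1 := by
  obtain ⟨h1, h2, h3⟩ := Q_three_of_Q_zero_three_eq_one hθ hs
  have h30 := P.sum_valency_mul_Q_mul_Q 3 0
  rw [Fin.sum_univ_four, if_neg (by decide)] at h30
  simp only [S.valency_zero, Nat.cast_one, P.Q_zero_right, hs, h1, h2, h3] at h30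
  have hcast : (S.valency 1 + S.valency 3 : ℝ) = S.valency 2 + 1 := by linear_combination -h30
  exact_mod_cast hcast

theorem valency_two_eq (hθ : StrictAnti fun h => P.Q h 1) (hs : P.Q 0 3 = 1) :
    (S.valency 2 : ℝ) = P.Q 0 1 ∧ S.valency 1 * P.Q 1 1 + S.valency 3 * P.Q 3 1 = 0 := by
  obtain ⟨h1, h2, h3⟩ := Q_three_of_Q_zero_three_eq_one hθ hs
  have h21 := Q_two_one_of_Q_zero_three_eq_one hθ hs
  have h10 := P.sum_valency_mul_Q_mul_Q 1 0
  have h13 := P.sum_valency_mul_Q_mul_Q 1 3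
  rw [Fin.sum_univ_four, if_neg (by decide)] at h10 h13
  simp only [S.valency_zero, Nat.cast_one, P.Q_zero_right, hs, h1, h2, h3, h21] at h10 h13
  constructor <;> linarith

theorem valency_sub_one_mul (hθ : StrictAnti fun h => P.Q h 1) (hs : P.Q 0 3 = 1) :
    ((S.valency 1 : ℝ) - 1) * (S.valency 3 - 1) * (P.Q 0 1 + 1) ^ 2 =
      4 * P.krein 1 1 1 * P.krein 1 2 1 * (S.valency 1 * S.valency 3) := by
  obtain ⟨h1, -, h3⟩ := Q_three_of_Q_zero_three_eq_one hθ hs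
  obtain ⟨hadd, hmul⟩ := Q_one_add_and_mul hs (by decide) h1 h3
  obtain ⟨h2, horth⟩ := valency_two_eq hθ hs
  have hk : (S.valency 1 + S.valency 3 : ℝ) = P.Q 0 1 + 1 := by
    rw [← h2]
    exact_mod_cast valency_one_add_valency_three hθ hs
  have hdiff : (P.Q 1 1 - P.Q 3 1) ^ 2 =
      (P.Q 0 1 + 1) ^ 2 - 4 * P.krein 1 1 1 * P.krein 1 2 1 := by
    linear_combination (P.Q 1 1 + P.Q 3 1 + P.krein 1 1 1 - P.krein 1 2 1) * hadd - 4 * hmul +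
      (P.krein 1 1 1 + P.krein 1 2 1 + P.Q 0 1 - 1) * P.one_add_krein
  have hprod : (S.valency 1 * S.valency 3 : ℝ) * (P.Q 1 1 - P.Q 3 1) ^ 2 =
      P.Q 0 1 * (P.Q 0 1 + 1) ^ 2 := by
    rw [← hk]
    linear_combination (S.valency 1 * P.Q 3 1 + S.valency 3 * P.Q 1 1) * horth -
      (S.valency 1 + S.valency 3 : ℝ) ^ 2 * hmul
  linear_combination hprod - (S.valency 1 * S.valency 3) * hdiff - (P.Q 0 1 + 1) ^ 2 * hk

theorem isDualTight_iff_Q_zero_three (hθ : StrictAnti fun h => P.Q h 1) :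
    P.IsDualTight ↔ P.Q 0 3 = 1 ∧ 1 < S.valency 1 ∧ 1 < S.valency 3 := by
  have hpos (h : Fin 4) : (1 : ℝ) ≤ S.valency h := by exact_mod_cast S.valency_pos h
  constructor
  · intro hP
    have hs := Q_zero_three_of_isDualTight hθ hP
    have ha := krein_one_one_one_pos_of_isDualTight hθ hP
    have hb := P.krein_one_two_one_pos
    have hprod : 0 < ((S.valency 1 : ℝ) - 1) * (S.valency 3 - 1) := by
      refine pos_of_mul_pos_left ?_ (sq_nonneg (P.Q 0 1 + 1))
      rw [valency_sub_one_mul hθ hs]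
      have := hpos 1
      have := hpos 3
      positivity
    have hne := mul_ne_zero_iff.1 hprod.ne'
    have hlt {h : Fin 4} (hh : (S.valency h : ℝ) - 1 ≠ 0) : 1 < S.valency h := by
      exact_mod_cast (hpos h).lt_of_ne' (sub_ne_zero.1 hh)
    exact ⟨hs, hlt hne.1, hlt hne.2⟩
  · rintro ⟨hs, hk₁, hk₃⟩
    obtain ⟨h1, -, h3⟩ := Q_three_of_Q_zero_three_eq_one hθ hs
    refine (isDualTight_iff hθ).2 ⟨fun hbip => ?_,
      tightDefect_eq_zero_of_Q_three_eq_neg_one hs (by decide) h1 h3⟩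
    have hprod := valency_sub_one_mul hθ hs
    rw [show P.krein 1 1 1 = 0 from hbip 1, mul_zero, zero_mul, zero_mul] at hprod
    have hk₁' : (0 : ℝ) < S.valency 1 - 1 := sub_pos.2 (by exact_mod_cast hk₁)
    have hk₃' : (0 : ℝ) < S.valency 3 - 1 := sub_pos.2 (by exact_mod_cast hk₃)
    have hm := P.Q_zero_pos 1
    exact absurd hprod (by positivity)

end Bipartite

end ClassThree

end QPolynomialStructure

namespace SymmetricDesign

variable {P B : Type u} [Fintype P] [Fintype B]

theorem nonempty_blocks (D : SymmetricDesign P B) : Nonempty B :=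
  Fintype.card_pos_iff.1 <| by rw [D.card_blocks]; exact (Nat.zero_le _).trans_lt D.k_lt

variable (D : SymmetricDesign P B)

theorem exists_block {p q : P} (hpq : p ≠ q) : ∃ b, D.inc p b ∧ D.inc q b := by
  obtain ⟨b⟩ := D.nonempty_blocks
  have hk := D.one_lt_k
  rw [← D.block_size b, Set.one_lt_ncard] at hk
  obtain ⟨p', hp', q', hq', hne⟩ := hk
  have hl : D.l ≠ 0 := by
    rw [← D.balanced p' q' hne]
    exact Set.ncard_ne_zero_of_mem (a := b) ⟨hp', hq'⟩
  exact Set.nonempty_of_ncard_ne_zero ((D.balanced p q hpq).trans_ne hl)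

theorem ncard_neighborSet_inr (b : B) : (D.incidenceGraph.neighborSet (.inr b)).ncard = D.k := by
  rw [← D.block_size b,
    ← Set.ncard_image_of_injective {p | D.inc p b} (Sum.inl_injective (β := B))]
  refine congrArg Set.ncard (Set.ext ?_)
  rintro (p | c)
  · exact (Sum.inl_injective.mem_set_image (s := {p | D.inc p b})).symm
  · exact iff_of_false id fun ⟨_, _, h⟩ => Sum.inl_ne_inr h

variable {D}

theorem isLeft_iff_of_adj {u w : P ⊕ B} (h : D.incidenceGraph.Adj u w) :
    u.isLeft ↔ ¬ w.isLeft := by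
  rcases u with p | b <;> rcases w with q | c
  · exact h.elim
  · simp
  · simp
  · exact h.elim

end SymmetricDesign

namespace AssociationScheme

open Finset

variable {X : Type u} [Fintype X] {d : ℕ} {S : AssociationScheme X d} {side : X → Prop}
  {T : Set (Fin (d + 1))} {i j : Fin (d + 1)}

theorem IsBipartition.ncard_side_iff (hS : S.IsBipartition side T)
    (hj : ∀ h, h ∉ T ↔ h = 0 ∨ h = j) (hkj : 1 < S.valency j) (x : X) :
    {y | side x ↔ side y}.ncard = S.valency j + 1 := by
  classical
  have hset : {y | side x ↔ side y} =
      (({y | S.rel x y = 0} : Finset X) ∪ ({y | S.rel x y = j} : Finset X) : Finset X) := by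
    ext y
    rw [mem_coe, mem_union, mem_filter_univ, mem_filter_univ, ← hj, hS, not_not, Set.mem_ofPred_eq]
  have hdisj : Disjoint ({y | S.rel x y = 0} : Finset X) ({y | S.rel x y = j} : Finset X) :=
    disjoint_filter.2 fun y _ h0 hyj => hkj.ne' <| by rw [← hyj, h0, S.valency_zero]
  rw [hset, Set.ncard_coe_finset, card_union_of_disjoint hdisj, S.card_rel, S.card_rel,
    S.valency_zero, add_comm]

theorem IsBipartition.exists_side (hS : S.IsBipartition side T) (hi : i ∈ T) :
    ∃ x y, side x ∧ ¬ side y ∧ S.rel x y = i := by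
  obtain ⟨x, y, hxy⟩ := S.rel_nonempty i
  have hne := (hS x y).1 (hxy ▸ hi)
  by_cases hx : side x
  · exact ⟨x, y, hx, by tauto, hxy⟩
  · exact ⟨y, x, by tauto, hx, (S.rel_symm y x).trans hxy⟩

theorem IsBipartition.rel_eq_of_side_iff (hS : S.IsBipartition side T)
    (hj : ∀ h, h ∉ T ↔ h = 0 ∨ h = j) {x y : X} (hxy : x ≠ y) (hside : side x ↔ side y) :
    S.rel x y = j :=
  ((hj _).1 ((hS x y).not.2 (not_not.2 hside))).resolve_left fun h =>
    hxy ((S.rel_eq_zero_iff x y).1 h)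

/-- The design whose points and blocks are the parts of a bipartition of a scheme in which distinct
vertices on the same side are always in relation `R_j`, a point being incident with the blocks to
which it is in relation `R_i`. -/
noncomputable def IsBipartition.design (hS : S.IsBipartition side T) (hi : i ∈ T)
    (hj : ∀ h, h ∉ T ↔ h = 0 ∨ h = j) (hk : 1 < S.valency i) (hlt : S.valency i < S.valency j)
    [Fintype {x // side x}] [Fintype {x // ¬ side x}] :
    SymmetricDesign {x // side x} {x // ¬ side x} where
  inc p b := S.rel p b = i
  v := S.valency j + 1
  k := S.valency i
  l := (S.regular i i j).choose
  card_points := by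
    obtain ⟨x, -, hx, -⟩ := hS.exists_side hi
    rw [← hS.ncard_side_iff hj (hk.trans hlt) x, ← Nat.card_eq_fintype_card]
    simp only [hx, true_iff]
    rfl
  card_blocks := by
    obtain ⟨-, y, -, hy, -⟩ := hS.exists_side hi
    rw [← hS.ncard_side_iff hj (hk.trans hlt) y, ← Nat.card_eq_fintype_card]
    simp only [hy, false_iff]
    rfl
  block_size b := by
    have hside (x : X) (hx : S.rel x b = i) : side x := by
      have := (hS x b).1 (hx ▸ hi)
      have := b.2
      tauto
    simp only [← S.card_rel i b, S.rel_symm b]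
    exact ncard_subtype_of_imp hside
  balanced p q hpq := by
    have hpq' : S.rel p q = j :=
      hS.rel_eq_of_side_iff hj (Subtype.coe_injective.ne hpq) (iff_of_true p.2 q.2)
    have hside (x : X) (hx : S.rel p x = i ∧ S.rel x q = i) : ¬ side x := by
      have := (hS p x).1 (hx.1 ▸ hi)
      have := p.2
      tauto
    simp only [← (S.regular i i j).choose_spec p q hpq', S.rel_symm q]
    exact ncard_subtype_of_imp hside
  one_lt_k := hk
  k_lt := by lia

theorem isSymmetricDesignIncidenceGraph_graph (hS : S.IsBipartition side T) (hi : i ∈ T)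
    (hi0 : i ≠ 0) (hj : ∀ h, h ∉ T ↔ h = 0 ∨ h = j) (hk : 1 < S.valency i)
    (hlt : S.valency i < S.valency j) : IsSymmetricDesignIncidenceGraph (S.graph i hi0) := by
  classical
  refine ⟨_, _, inferInstance, inferInstance, hS.design hi hj hk hlt,
    ⟨RelIso.symm ⟨Equiv.sumCompl side, ?_⟩⟩⟩
  have hne {x y : X} (hxy : side x ↔ side y) : S.rel x y ≠ i := fun h =>
    (hS x y).1 (h.symm ▸ hi) hxy
  rintro (p | b) (q | c)
  · exact iff_of_false (hne (iff_of_true p.2 q.2)) id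
  · exact Iff.rfl
  · exact Iff.of_eq (congrArg (· = i) (S.rel_symm b q))
  · exact iff_of_false (hne (iff_of_false b.2 c.2)) id

theorem exists_rel_of_rel_eq {x y x' y' z : X} (h : S.rel x y = S.rel x' y') :
    ∃ w, S.rel x' w = S.rel x z ∧ S.rel w y' = S.rel z y := by
  obtain ⟨n, hn⟩ := S.regular (S.rel x z) (S.rel z y) (S.rel x y)
  have hpos : 0 < n := hn x y rfl ▸ Finset.card_pos.2 ⟨z, by simp⟩
  obtain ⟨w, hw⟩ := Finset.card_pos.1 (hpos.trans_eq (hn x' y' h.symm).symm)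
  exact ⟨w, (mem_filter.1 hw).2⟩

theorem ncard_rel_mem (T : Set (Fin (d + 1))) (x y : X) :
    {z | S.rel x z ∈ T}.ncard = {z | S.rel y z ∈ T}.ncard := by
  classical
  have hsum (x : X) : {z | S.rel x z ∈ T}.ncard =
      ∑ h, S.valency h * if h ∈ T then 1 else 0 := by
    rw [← Nat.cast_id (Set.ncard _), Set.ncard_eq_toFinset_card', Set.toFinset_ofPred, card_filter]
    exact S.sum_rel (fun h => if h ∈ T then 1 else 0) x
  rw [hsum, hsum]

theorem isBipartition_of_ncard_eq (hcross : ∀ x y, ¬ (side x ↔ side y) → S.rel x y ∈ T)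
    (hside : ∀ x y, side x → side y → S.rel x y ∉ T)
    (hcard : {x | side x}.ncard = {x | ¬ side x}.ncard) : S.IsBipartition side T := by
  have hrel_side {x : X} (hx : side x) : {z | S.rel x z ∈ T} = {z | ¬ side z} := by
    ext z
    exact ⟨fun hz hz' => hside x z hx hz' hz, fun hz => hcross x z (by tauto)⟩
  have hrel_not_side {y : X} (hy : ¬ side y) : {z | S.rel y z ∈ T} = {z | side z} := by
    obtain ⟨x, hx⟩ : {x | side x}.Nonempty := Set.nonempty_of_ncard_ne_zero
      (hcard.trans_ne (Set.ncard_ne_zero_of_mem (a := y) hy))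
    refine (Set.eq_of_subset_of_ncard_le (t := {z | S.rel y z ∈ T})
      (fun z hz => hcross y z (by tauto)) ?_).symm
    rw [S.ncard_rel_mem T y x, hrel_side hx, hcard]
  intro x y
  by_cases hx : side x
  · exact (Set.ext_iff.1 (hrel_side hx) y).trans (by tauto)
  · exact (Set.ext_iff.1 (hrel_not_side hx) y).trans (by tauto)

section Iso

variable {P B : Type u} [Fintype P] [Fintype B] {D : SymmetricDesign P B} {hi : i ≠ 0}

theorem valency_eq_k (e : S.graph i hi ≃g D.incidenceGraph) : S.valency i = D.k := by
  obtain ⟨b⟩ := D.nonempty_blocks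
  have hcongr := Nat.card_congr (e.mapNeighborSet (e.symm (.inr b)))
  rw [Nat.card_coe_set_eq, Nat.card_coe_set_eq, e.apply_symm_apply,
    D.ncard_neighborSet_inr] at hcongr
  classical
  rw [← hcongr, ← S.card_rel i (e.symm (.inr b)), ← Set.ncard_coe_finset, coe_filter_univ]
  rfl

theorem card_eq_two_mul_v (e : S.graph i hi ≃g D.incidenceGraph) : Fintype.card X = 2 * D.v := by
  rw [Fintype.card_congr e.toEquiv, Fintype.card_sum, D.card_points, D.card_blocks, two_mul]

theorem ncard_isLeft (e : S.graph i hi ≃g D.incidenceGraph) :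
    {x | (e x).isLeft}.ncard = {x | ¬ (e x).isLeft}.ncard := by
  have hpre (s : Set (P ⊕ B)) : (e ⁻¹' s).ncard = s.ncard :=
    Set.ncard_preimage_of_injective_subset_range e.injective
      (e.surjective.range_eq ▸ Set.subset_univ s)
  have hleft : {x | (e x).isLeft} = e ⁻¹' (Sum.inl '' Set.univ) := by
    rw [Set.image_univ, Set.range_inl]
    rfl
  have hright : {x | ¬ (e x).isLeft} = e ⁻¹' (Sum.inr '' Set.univ) := by
    rw [Set.image_univ, Set.range_inr]
    ext x
    simp only [Set.mem_ofPred_eq, Set.mem_preimage, Sum.not_isLeft]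
  rw [hleft, hright, hpre, hpre, Set.ncard_image_of_injective _ Sum.inl_injective,
    Set.ncard_image_of_injective _ Sum.inr_injective, Set.ncard_univ, Set.ncard_univ,
    Nat.card_eq_fintype_card, Nat.card_eq_fintype_card, D.card_points, D.card_blocks]

theorem exists_common_neighbor (e : S.graph i hi ≃g D.incidenceGraph) {x y : X} (hxy : x ≠ y)
    (hx : (e x).isLeft) (hy : (e y).isLeft) : ∃ z, S.rel x z = i ∧ S.rel z y = i := by
  obtain ⟨p, hp⟩ := Sum.isLeft_iff.1 hx
  obtain ⟨q, hq⟩ := Sum.isLeft_iff.1 hy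
  obtain ⟨b, hpb, hqb⟩ := D.exists_block (p := p) (q := q) fun h =>
    hxy (e.injective (by rw [hp, hq, h]))
  refine ⟨e.symm (.inr b), e.map_rel_iff.1 ?_, e.map_rel_iff.1 ?_⟩
  · rwa [hp, e.apply_symm_apply]
  · rwa [hq, e.apply_symm_apply]

theorem exists_isBipartition_of_iso (e : S.graph i hi ≃g D.incidenceGraph) :
    ∃ (side : X → Prop) (T : Set (Fin (d + 1))), S.IsBipartition side T ∧ i ∈ T := by
  have hadj {x y : X} (h : S.rel x y = i) : (e x).isLeft ↔ ¬ (e y).isLeft :=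
    D.isLeft_iff_of_adj (e.map_rel_iff.2 h)
  let T : Set (Fin (d + 1)) := {h | ∃ x y, (e x).isLeft ∧ ¬ (e y).isLeft ∧ S.rel x y = h}
  have hcross {x y : X} (hx : (e x).isLeft) (hy : ¬ (e y).isLeft) : S.rel x y ∈ T :=
    ⟨x, y, hx, hy, rfl⟩
  have hS : S.IsBipartition (fun x => (e x).isLeft) T := by
    refine isBipartition_of_ncard_eq (fun x y hxy => ?_) (fun x y hx hy => ?_) (ncard_isLeft e)
    · by_cases hx : (e x).isLeft
      · exact hcross hx (by tauto)
      · exact S.rel_symm y x ▸ hcross (by tauto) hx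
    · rintro ⟨x', y', hx', hy', hrel⟩
      have hxy : x ≠ y := by
        rintro rfl
        rw [S.rel_self, S.rel_eq_zero_iff] at hrel
        exact hy' (hrel ▸ hx')
      obtain ⟨z, hxz, hzy⟩ := exists_common_neighbor e hxy hx hy
      obtain ⟨w, hxw, hwy⟩ := exists_rel_of_rel_eq (z := z) hrel.symm
      have := hadj (hxw.trans hxz)
      have := hadj (hwy.trans hzy)
      tauto
  obtain ⟨x, y, hxy⟩ := S.rel_nonempty i
  refine ⟨_, T, hS, ?_⟩
  rw [← hxy, hS]
  exact fun h => by have := hadj hxy; tauto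

end Iso

end AssociationScheme

namespace QPolynomialStructure

variable {X : Type u} [Fintype X] [DecidableEq X] {S : AssociationScheme X 3}
  {P : QPolynomialStructure S}

theorem exists_isSymmetricDesignIncidenceGraph_of_isDualTight (hθ : StrictAnti fun h => P.Q h 1)
    (hP : P.IsDualTight) :
    ∃ (i : Fin 4) (hi : i ≠ 0), IsSymmetricDesignIncidenceGraph (S.graph i hi) := by
  obtain ⟨hs, hk₁, hk₃⟩ := (isDualTight_iff_Q_zero_three hθ).1 hP
  obtain ⟨h1, h2, h3⟩ := Q_three_of_Q_zero_three_eq_one hθ hs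
  have hk := valency_one_add_valency_three hθ hs
  obtain ⟨x₀, -⟩ := S.rel_nonempty 0
  have hT (h : Fin 4) : h ∉ {h | P.Q h 3 = -1} ↔ h = 0 ∨ h = 2 := by
    rw [Set.mem_ofPred_eq]
    match h with
    | 0 | 1 | 2 | 3 => norm_num +decide [hs, h1, h2, h3]
  exact ⟨1, by decide, AssociationScheme.isSymmetricDesignIncidenceGraph_graph
    (P.isBipartition_of_Q_zero_eq_one hs x₀) h1 (by decide) hT hk₁ (by lia)⟩

theorem isDualTight_of_isSymmetricDesignIncidenceGraph (hθ : StrictAnti fun h => P.Q h 1)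
    {i : Fin 4} {hi : i ≠ 0} (h : IsSymmetricDesignIncidenceGraph (S.graph i hi)) :
    P.IsDualTight := by
  obtain ⟨_, _, _, _, D, ⟨e⟩⟩ := h
  obtain ⟨side, T, hS, hiT⟩ := AssociationScheme.exists_isBipartition_of_iso e
  obtain ⟨s, hs, hT⟩ := P.exists_Q_zero_eq_one_of_isBipartition hS
  have hs0 : s ≠ 0 := by
    rintro rfl
    have := (hT i).1 hiT
    rw [P.Q_zero_right] at this
    norm_num at this
  obtain rfl : s = 3 := P.eq_last_of_Q_zero_eq_one hs hs0
  obtain ⟨-, h2, -⟩ := Q_three_of_Q_zero_three_eq_one hθ hs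
  have hi2 : i ≠ 2 := by
    rintro rfl
    have := (hT 2).1 hiT
    norm_num [h2] at this
  have hi13 : i = 1 ∨ i = 3 := by lia
  have hcard := S.sum_valency
  rw [Fin.sum_univ_four, S.valency_zero, AssociationScheme.card_eq_two_mul_v e] at hcard
  have hk := valency_one_add_valency_three hθ hs
  have hki := AssociationScheme.valency_eq_k e
  have hk₁ := D.one_lt_k
  have hk₂ := D.k_lt
  refine (isDualTight_iff_Q_zero_three hθ).2 ⟨hs, ?_⟩
  rcases hi13 with rfl | rfl <;> lia

end QPolynomialStructure

theorem theorem5p1 {X : Type u} [Fintype X] [DecidableEq X] (S : AssociationScheme X 3)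
    (P : QPolynomialStructure S) :
    P.IsDualTight ↔
      ∃ (i : Fin 4) (hi : i ≠ 0), IsSymmetricDesignIncidenceGraph (S.graph i hi) := by
  obtain ⟨e, he, hθ⟩ := P.exists_perm_strictAnti
  rw [← QPolynomialStructure.isDualTight_renumber P e he, ← S.exists_graph_renumber_iff e he]
  exact ⟨QPolynomialStructure.exists_isSymmetricDesignIncidenceGraph_of_isDualTight hθ,
    fun ⟨_, _, h⟩ => QPolynomialStructure.isDualTight_of_isSymmetricDesignIncidenceGraph hθ h⟩
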